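/- For $K\subset\mathbb R$ compact, a function $y:K\to\mathbb R$ is called Gevrey of order $s$ on $K$ if it is the restriction to $K$ of a function that is $C^\infty$ on an open neighbourhood of $K$ and whose derivatives satisfy, for some constants $M,R>0$, $|y^{(p)}(t)|\le M\,(p!)^s/R^p$ for all $t\in K$, $p\ge 0$. Similarly, for $K\subset\mathbb R^2$ compact, $\theta:K\to\mathbb R$ is Gevrey of order $s_1$ in $t$ and $s_2$ in $x$ on $K$ if it is the restriction to $K$ of a function that is $C^\infty$ on an open neighbourhood of $K$ and whose partial derivatives satisfy, for some $M,R_1,R_2>0$, $|\partial_t^p\partial_x^q\theta(t,x)|\le M\,(p!)^{s_1}(q!)^{s_2}/(R_1^pR_2^q)$ for all $(t,x)\in K$, $p,q\ge0$. Consider the system $$\theta_t-\theta_{xx}=0\ \text{ on }(0,T)\times(0,1),\qquad \theta_x(t,0)=0,\quad \theta_x(t,1)=u(t)\ \text{ for } t\in(0,T),\qquad \theta(0,\cdot)=\theta_0,$$ whose weak solutions are the functions $\theta:[0,T]\to L^2(0,1)$ with $\theta(0)=\theta_0$ such that, for each $\varphi\in C^2([0,1])$ with $\varphi'(0)=\varphi'(1)=0$,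 the function $r\mapsto\int_0^1\theta(r,x)\varphi''(x)\,dx+u(r)\varphi(1)$ is integrable on $(0,T)$ and, for all $t\in[0,T]$, $$\int_0^1\theta(t,x)\varphi(x)\,dx=\int_0^1\theta_0(x)\varphi(x)\,dx+\int_0^t\Bigl(\int_0^1\theta(r,x)\varphi''(x)\,dx+u(r)\varphi(1)\Bigr)dr .$$ Theorem. Let $\theta_0\in L^2(0,1)$ (real-valued), $T>0$, $\tau\in(0,T)$ and $s\in(1,2)$. Then there exists a function $y$, Gevrey of order $s$ on $[\tau,T]$, such that the series below converges for every $t\in(\tau,T]$ and the control $$u(t):=\begin{cases}0 & \text{if } 0\le t\le\tau,\\ \displaystyle\sum_{i\ge1}\frac{y^{(i)}(t)}{(2i-1)!} & \text{if }\tau<t\le T\end{cases}$$ steers the system from the initial state $\theta_0$ at time $0$ to the final state $0$ at time $T$: the system has a unique weak solution $\theta$, this solution (after a choice of representatives) satisfies the heat equation and both boundary conditions pointwise, and $\theta(T,x)=0$ for $x\in(0,1)$. Moreover, $u$ is Gevrey of order $s$ on $[0,T]$; the map $t\mapsto\theta(t,\cdot)$ is in $C([0,T],L^2(0,1))$; and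 $\theta$ is Gevrey of order $s$ in $t$ and $s/2$ in $x$ on $[\varepsilon,T]\times[0,1]$ for every $\varepsilon\in(0,T)$. -/

import Mathlib

namespace HeatControl

/-- The real Hilbert space `L²(0,1)`. -/
abbrev L2 : Type :=
  MeasureTheory.Lp ℝ 2 (MeasureTheory.volume.restrict (Set.Ioo (0 : ℝ) 1))

/-- `y` is Gevrey of order `s` on `K ⊆ ℝ`: it is the restriction to `K` of a function `g` which is
`C^∞` on an open neighbourhood of `K`, and whose derivatives satisfy
`|g⁽ᵖ⁾(t)| ≤ M (p!)^s / R^p` for `t ∈ K`. -/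
def GevreyOn (s : ℝ) (y : ℝ → ℝ) (K : Set ℝ) : Prop :=
  ∃ (U : Set ℝ) (g : ℝ → ℝ), IsOpen U ∧ K ⊆ U ∧
    ContDiffOn ℝ ((⊤ : ℕ∞) : WithTop ℕ∞) g U ∧ (∀ t ∈ K, y t = g t) ∧
    ∃ M R : ℝ, 0 < M ∧ 0 < R ∧ ∀ (p : ℕ), ∀ t ∈ K,
      |iteratedDeriv p g t| ≤ M * (Nat.factorial p : ℝ) ^ s / R ^ p

/-- `θ` is Gevrey of order `s₁` in its first variable and `s₂` in its second variable on
`K ⊆ ℝ × ℝ`: it is the restriction to `K` of a function `g` which is `C^∞` on an open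
neighbourhood of `K`, and whose partial derivatives satisfy
`|∂_t^p ∂_x^q g(t,x)| ≤ M (p!)^s₁ (q!)^s₂ / (R₁^p R₂^q)` for `(t,x) ∈ K`. -/
def GevreyOn₂ (s₁ s₂ : ℝ) (θ : ℝ → ℝ → ℝ) (K : Set (ℝ × ℝ)) : Prop :=
  ∃ (U : Set (ℝ × ℝ)) (g : ℝ → ℝ → ℝ), IsOpen U ∧ K ⊆ U ∧
    ContDiffOn ℝ ((⊤ : ℕ∞) : WithTop ℕ∞) (fun z : ℝ × ℝ => g z.1 z.2) U ∧
    (∀ z ∈ K, θ z.1 z.2 = g z.1 z.2) ∧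
    ∃ M R₁ R₂ : ℝ, 0 < M ∧ 0 < R₁ ∧ 0 < R₂ ∧ ∀ (p q : ℕ), ∀ z ∈ K,
      |iteratedDeriv p (fun t : ℝ => iteratedDeriv q (fun x : ℝ => g t x) z.2) z.1| ≤
        M * ((Nat.factorial p : ℝ) ^ s₁ * (Nat.factorial q : ℝ) ^ s₂) / (R₁ ^ p * R₂ ^ q)

/-- The `i`-th term (`i = 0, 1, 2, …`, shifted by one) of the series
`∑_{i ≥ 1} y⁽ⁱ⁾(t) / (2i-1)!`, the derivatives being those of `y` on `[τ, T]`
(one-sided at the end points). -/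
noncomputable def controlTerm (τ T : ℝ) (y : ℝ → ℝ) (t : ℝ) (i : ℕ) : ℝ :=
  iteratedDerivWithin (i + 1) y (Set.Icc τ T) t / (Nat.factorial (2 * i + 1) : ℝ)

/-- The control `u(t) = 0` for `t ≤ τ`, `u(t) = ∑_{i ≥ 1} y⁽ⁱ⁾(t) / (2i-1)!` for `t > τ`. -/
noncomputable def control (τ T : ℝ) (y : ℝ → ℝ) (t : ℝ) : ℝ :=
  if t ≤ τ then 0 else ∑' i : ℕ, controlTerm τ T y t i

/-- Weak solutions on `[0, T]`, with values in `L²(0,1)`, of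
`θ_t = θ_xx`, `θ_x(t,0) = 0`, `θ_x(t,1) = u(t)`, `θ(0,·) = θ₀`:
for each `φ` of class `C²` with `φ'(0) = φ'(1) = 0`, the function `t ↦ ⟨θ(t), φ⟩` is the
primitive on `[0, T]` of the integrable function `r ↦ ⟨θ(r), φ''⟩ + u(r) φ(1)`. -/
structure IsWeakSolution (T : ℝ) (u : ℝ → ℝ) (θ₀ : L2) (Θ : ℝ → L2) : Prop where
  initial : Θ 0 = θ₀
  integrable : ∀ φ : ℝ → ℝ, ContDiff ℝ 2 φ → deriv φ 0 = 0 → deriv φ 1 = 0 →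
    IntervalIntegrable
      (fun r => (∫ x in Set.Ioo (0 : ℝ) 1, (Θ r : ℝ → ℝ) x * deriv (deriv φ) x) + u r * φ 1)
      MeasureTheory.volume 0 T
  weak : ∀ φ : ℝ → ℝ, ContDiff ℝ 2 φ → deriv φ 0 = 0 → deriv φ 1 = 0 →
    ∀ t ∈ Set.Icc (0 : ℝ) T,
      (∫ x in Set.Ioo (0 : ℝ) 1, (Θ t : ℝ → ℝ) x * φ x) =
        (∫ x in Set.Ioo (0 : ℝ) 1, (θ₀ : ℝ → ℝ) x * φ x) +
        ∫ r in (0 : ℝ)..t,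
          ((∫ x in Set.Ioo (0 : ℝ) 1, (Θ r : ℝ → ℝ) x * deriv (deriv φ) x) + u r * φ 1)

/-- `θ` satisfies the boundary value problem
`θ_t = θ_xx` on `(0,T) × (0,1)`, `θ_x(t,0) = 0` and `θ_x(t,1) = u(t)` for `t ∈ (0,T)`, pointwise;
all the derivatives are asserted to exist (one-sided ones at `x = 0` and `x = 1`). -/
structure SatisfiesHeatEquation (T : ℝ) (u : ℝ → ℝ) (θ : ℝ → ℝ → ℝ) : Prop where
  heat : ∀ t ∈ Set.Ioo (0 : ℝ) T, ∀ x ∈ Set.Ioo (0 : ℝ) 1,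
    DifferentiableAt ℝ (θ t) x ∧
      ∃ a : ℝ, HasDerivAt (fun r => θ r x) a t ∧ HasDerivAt (deriv (θ t)) a x
  left : ∀ t ∈ Set.Ioo (0 : ℝ) T, HasDerivWithinAt (θ t) 0 (Set.Icc 0 1) 0
  right : ∀ t ∈ Set.Ioo (0 : ℝ) T, HasDerivWithinAt (θ t) (u t) (Set.Icc 0 1) 1

end HeatControl

/-! The heat equation with θ_x(t,0) = 0 is flat, with output y(t) = θ(t,0): solving it as a Cauchy
problem in x gives θ(t,x) = ∑ x²ⁱ y⁽ⁱ⁾(t)/(2i)!, and the control is then the flux θ_x(t,1) = ∑_{i≥1}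
y⁽ⁱ⁾(t)/(2i-1)!. If y is Gevrey of order s < 2, then (i!)^s ≤ ((2i)!)^(s/2) makes this series and
all its derivatives converge for every x, with order s in t and s/2 in x (`abs_evenCoeff_le`,
`summable_flatWeight`). Steering reduces to the choice of y.

Without control, θ₀ evolves into ∑ cₖ exp(-(kπ)²t) cos(kπx). Its output ∑ cₖ exp(-(kπ)²t) is Gevrey
of order 1 on (δ,∞) for each δ > 0, and the flat series of this output is the free evolution again
(`flatSeries_freeJet`). The output is multiplied by a step of order s, equal to 1 up to τ and to 0
from T on; such steps exist because s > 1 (`exists_gevrey_step`). Up to τ the solution is the free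
one, with no flux at x = 1; at T all derivatives of y vanish, hence so does the state.

The flat series solves the weak equation by differentiation under the integral and two integrations
by parts (`IsFlatOutput.hasDerivAt_integral_mul`); continuity at t = 0 is Parseval's identity in the
cosine basis (`tendsto_of_inner_cosLp`). For uniqueness, each cosine coefficient of a difference of
two solutions solves a homogeneous linear equation with zero initial value, and the cosines are
total.

Derivatives are carried as explicit sequences of functions, so that products and shifts of the
output become algebra on indices. -/

namespace HeatControl

/-! ### Jets, Leibniz products and Gevrey bounds -/

open Finset in
/-- The Leibniz product of two sequences of functions. -/
noncomputable def leibniz (a b : ℕ → ℝ → ℝ) (n : ℕ) (t : ℝ) : ℝ :=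
  ∑ ij ∈ antidiagonal n, (n.choose ij.1 : ℝ) * (a ij.1 t * b ij.2 t)

/-- Each function of the sequence `a` has the next one as its derivative on `U`. -/
def IsJet (U : Set ℝ) (a : ℕ → ℝ → ℝ) : Prop :=
  ∀ n, ∀ t ∈ U, HasDerivAt (a n) (a (n + 1) t) t

/-- Gevrey bounds of order `s` for a sequence of functions on `S`. -/
def IsGevreyJet (s M A : ℝ) (a : ℕ → ℝ → ℝ) (S : Set ℝ) : Prop :=
  ∀ n, ∀ t ∈ S, |a n t| ≤ M * (n.factorial : ℝ) ^ s * A ^ n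

theorem IsJet.mono {U V : Set ℝ} {a : ℕ → ℝ → ℝ} (h : IsJet U a) (hV : V ⊆ U) : IsJet V a :=
  fun n t ht => h n t (hV ht)

theorem IsJet.continuousAt {U : Set ℝ} {a : ℕ → ℝ → ℝ} (h : IsJet U a) (n : ℕ) {t : ℝ}
    (ht : t ∈ U) : ContinuousAt (a n) t :=
  (h n t ht).continuousAt

theorem IsJet.iteratedDeriv_eq {U : Set ℝ} (hU : IsOpen U) {a : ℕ → ℝ → ℝ} (h : IsJet U a)
    (n : ℕ) : ∀ t ∈ U, iteratedDeriv n (a 0) t = a n t := by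
  induction n with
  | zero => simp
  | succ n ih =>
    intro t ht
    rw [iteratedDeriv_succ]
    have : iteratedDeriv n (a 0) =ᶠ[nhds t] a n := by
      filter_upwards [hU.mem_nhds ht] with r hr using ih r hr
    rw [this.deriv_eq, (h n t ht).deriv]

theorem IsJet.contDiffOn {U : Set ℝ} (hU : IsOpen U) {a : ℕ → ℝ → ℝ} (h : IsJet U a) (n : ℕ) :
    ContDiffOn ℝ ((⊤ : ℕ∞) : WithTop ℕ∞) (a n) U := by
  rw [contDiffOn_infty]
  intro m
  induction m generalizing n with
  | zero =>
    exact contDiffOn_zero.2 fun t ht => (h.continuousAt n ht).continuousWithinAt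
  | succ m ih =>
    push_cast
    rw [contDiffOn_succ_iff_deriv_of_isOpen hU]
    refine ⟨fun t ht => (h n t ht).differentiableAt.differentiableWithinAt, by simp, ?_⟩
    exact (ih (n + 1)).congr fun t ht => (h n t ht).deriv

theorem IsJet.leibniz {U : Set ℝ} {a b : ℕ → ℝ → ℝ} (ha : IsJet U a) (hb : IsJet U b) :
    IsJet U (leibniz a b) := by
  intro n t ht
  have h : HasDerivAt (HeatControl.leibniz a b n)
      (∑ ij ∈ Finset.HasAntidiagonal.antidiagonal n, (n.choose ij.1 : ℝ) *
        (a (ij.1 + 1) t * b ij.2 t + a ij.1 t * b (ij.2 + 1) t)) t := by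
    unfold HeatControl.leibniz
    refine HasDerivAt.fun_sum fun ij _ => ?_
    exact ((ha ij.1 t ht).mul (hb ij.2 t ht)).const_mul _
  convert h using 1
  unfold HeatControl.leibniz
  rw [Finset.sum_antidiagonal_choose_succ_mul (fun i j => a i t * b j t) n,
    ← Finset.sum_add_distrib]
  refine Finset.sum_congr rfl fun ij hij => ?_
  have : n.choose ij.2 = n.choose ij.1 := by
    rw [Finset.HasAntidiagonal.mem_antidiagonal] at hij
    exact Nat.choose_symm_of_eq_add (by omega)
  rw [this]; ring

/-- Since i! j! ≤ (i+j)!, the factorial powers come out of the Leibniz sum, and what remains is the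
binomial expansion of (A+B)ⁿ. -/
theorem IsGevreyJet.leibniz {s M A N B : ℝ} {a b : ℕ → ℝ → ℝ} {S : Set ℝ} (hs : 0 ≤ s)
    (hM : 0 ≤ M) (hA : 0 ≤ A) (hN : 0 ≤ N) (hB : 0 ≤ B)
    (ha : IsGevreyJet s M A a S) (hb : IsGevreyJet s N B b S) :
    IsGevreyJet s (M * N) (A + B) (leibniz a b) S := by
  intro n t ht
  unfold HeatControl.leibniz
  refine (Finset.abs_sum_le_sum_abs _ _).trans ?_
  rw [(Commute.all A B).add_pow', Finset.mul_sum]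
  refine Finset.sum_le_sum fun ij hij => ?_
  rw [Finset.HasAntidiagonal.mem_antidiagonal] at hij
  rw [abs_mul, abs_mul, Nat.abs_cast, nsmul_eq_mul]
  have hfac : ((ij.1.factorial : ℝ)) ^ s * (ij.2.factorial : ℝ) ^ s ≤ (n.factorial : ℝ) ^ s := by
    rw [← Real.mul_rpow (by positivity) (by positivity)]
    refine Real.rpow_le_rpow (by positivity) ?_ hs
    rw [← hij]
    exact_mod_cast Nat.le_of_dvd (Nat.factorial_pos _)
      (Nat.factorial_mul_factorial_dvd_factorial_add ij.1 ij.2)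
  calc (n.choose ij.1 : ℝ) * (|a ij.1 t| * |b ij.2 t|)
      ≤ (n.choose ij.1 : ℝ) * ((M * (ij.1.factorial : ℝ) ^ s * A ^ ij.1) *
          (N * (ij.2.factorial : ℝ) ^ s * B ^ ij.2)) := by
        gcongr
        · exact ha _ t ht
        · exact hb _ t ht
    _ = ((ij.1.factorial : ℝ) ^ s * (ij.2.factorial : ℝ) ^ s) *
          (M * N * ((n.choose ij.1 : ℝ) * (A ^ ij.1 * B ^ ij.2))) := by ring
    _ ≤ (n.factorial : ℝ) ^ s * (M * N * ((n.choose ij.1 : ℝ) * (A ^ ij.1 * B ^ ij.2))) := by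
        gcongr
    _ = _ := by ring

theorem IsGevreyJet.gevreyOn {s M A : ℝ} {a : ℕ → ℝ → ℝ} {U K : Set ℝ} {y : ℝ → ℝ} (hM : 0 < M)
    (hA : 0 < A) (hU : IsOpen U) (hK : K ⊆ U) (ha : IsJet U a) (hb : IsGevreyJet s M A a K)
    (hy : ∀ t ∈ K, y t = a 0 t) : GevreyOn s y K := by
  refine ⟨U, a 0, hU, hK, ha.contDiffOn hU 0, hy, M, A⁻¹, hM, inv_pos.2 hA, fun p t ht => ?_⟩
  rw [ha.iteratedDeriv_eq hU p t (hK ht), inv_pow, div_inv_eq_mul]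
  exact hb p t ht

/-! ### The flat function exp(-t⁻ᵏ) is Gevrey of order 1 + 1/k -/

/-- The complex extension of the flat function `exp (-t⁻ᵏ)`. -/
noncomputable def flatExp (k : ℕ) (z : ℂ) : ℂ := Complex.exp (-(z ^ k)⁻¹)

/-- The derivatives of the function equal to `exp (-t⁻ᵏ)` for `t > 0` and to `0` for `t ≤ 0`. -/
noncomputable def flatJet (k n : ℕ) (t : ℝ) : ℝ :=
  if 0 < t then (iteratedDeriv n (flatExp k) t).re else 0

theorem differentiableOn_flatExp (k : ℕ) : DifferentiableOn ℂ (flatExp k) {0}ᶜ := by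
  intro z hz
  have hz : z ≠ 0 := hz
  unfold flatExp
  refine DifferentiableAt.differentiableWithinAt ?_
  have : z ^ k ≠ 0 := pow_ne_zero _ hz
  fun_prop (disch := assumption)

theorem hasDerivAt_iteratedDeriv_flatExp (k n : ℕ) {z : ℂ} (hz : z ≠ 0) :
    HasDerivAt (iteratedDeriv n (flatExp k)) (iteratedDeriv (n + 1) (flatExp k) z) z := by
  rw [iteratedDeriv_succ]
  refine DifferentiableAt.hasDerivAt ?_
  have h := (((differentiableOn_flatExp k).analyticOnNhd isOpen_compl_singleton).iterated_deriv
    n) z hz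
  rw [← iteratedDeriv_eq_iterate] at h
  exact h.differentiableAt

/-- Continuity at w = 1. Scaling z = t w turns this into decay of exp(-z⁻ᵏ) on a disc of radius ρt
about t; ρ < 1 keeps that disc away from the singularity at 0. -/
theorem exists_re_inv_pow_ge (k : ℕ) : ∃ ρ : ℝ, 0 < ρ ∧ ρ < 1 ∧
    ∀ w : ℂ, ‖w - 1‖ ≤ ρ → 1 / 2 ≤ ((w ^ k)⁻¹).re := by
  have hc : ContinuousAt (fun w : ℂ => ((w ^ k)⁻¹).re) 1 := by
    refine Complex.continuous_re.continuousAt.comp ?_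
    exact (continuousAt_id.pow k).inv₀ (by simp)
  have h := hc.eventually (lt_mem_nhds (a := (1 / 2 : ℝ)) (by norm_num))
  obtain ⟨δ, hδ, h⟩ := Metric.eventually_nhds_iff.1 h
  refine ⟨min (δ / 2) (1 / 2), by positivity, by
    exact (min_le_right _ _).trans_lt (by norm_num), fun w hw => ?_⟩
  refine (h ?_).le
  rw [dist_eq_norm]
  exact (hw.trans (min_le_left _ _)).trans_lt (by linarith)

/-- Cauchy's estimate on the circle of centre t and radius ρt. -/
theorem exists_norm_iteratedDeriv_flatExp_le (k : ℕ) : ∃ ρ : ℝ, 0 < ρ ∧ ∀ (n : ℕ) (t : ℝ), 0 < t →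
    ‖iteratedDeriv n (flatExp k) t‖ ≤
      n.factorial * Real.exp (-(1 / 2 * (t ^ k)⁻¹)) / (ρ * t) ^ n := by
  obtain ⟨ρ, hρ, hρ1, h⟩ := exists_re_inv_pow_ge k
  refine ⟨ρ, hρ, fun n t ht => ?_⟩
  refine Complex.norm_iteratedDeriv_le_of_forall_mem_sphere_norm_le n (by positivity) ?_ ?_
  · refine (differentiableOn_flatExp k).diffContOnCl_ball ?_
    intro z hz h0
    rw [Set.mem_singleton_iff] at h0
    rw [h0, Metric.mem_closedBall, dist_eq_norm, zero_sub, norm_neg, Complex.norm_real,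
      Real.norm_of_nonneg ht.le] at hz
    nlinarith
  · intro z hz
    rw [mem_sphere_iff_norm] at hz
    have htc : (t : ℂ) ≠ 0 := by exact_mod_cast ht.ne'
    set w : ℂ := z / t
    have hzw : z = t * w := by simp only [w]; field_simp
    have hw : ‖w - 1‖ ≤ ρ := by
      have : w - 1 = (z - t) / t := by simp only [w]; field_simp
      rw [this, norm_div, hz, Complex.norm_real, Real.norm_of_nonneg ht.le]
      field_simp; rfl
    have hre := h w hw
    rw [flatExp, Complex.norm_exp, Real.exp_le_exp, Complex.neg_re, neg_le_neg_iff, hzw, mul_pow,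
      mul_inv, ← Complex.ofReal_pow, ← Complex.ofReal_inv, Complex.re_ofReal_mul, mul_comm]
    gcongr

/-- The inequality xⁿ/n! ≤ eˣ at x = k t⁻ᵏ/2, followed by a k-th root. The factor (n!)^(1/k) is the
excess over the n! of Cauchy's estimate, whence the order 1 + 1/k. -/
theorem exp_mul_inv_pow_le {k : ℕ} (hk : 0 < k) (n : ℕ) {t : ℝ} (ht : 0 < t) :
    Real.exp (-(1 / 2 * (t ^ k)⁻¹)) / t ^ n ≤ (n.factorial : ℝ) ^ (1 / k : ℝ) * 2 ^ n := by
  have hk' : (0 : ℝ) < k := by exact_mod_cast hk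
  refine le_of_pow_le_pow_left₀ hk.ne' (by positivity) ?_
  have h1 : ((n.factorial : ℝ) ^ (1 / k : ℝ)) ^ k = n.factorial := by
    rw [← Real.rpow_natCast, ← Real.rpow_mul (by positivity)]
    rw [one_div_mul_cancel hk'.ne', Real.rpow_one]
  rw [mul_pow, h1, div_pow, ← Real.exp_nat_mul]
  have h2 := Real.pow_div_factorial_le_exp (x := k * (1 / 2 * (t ^ k)⁻¹)) (by positivity) n
  have h3 : (t ^ n) ^ k = (t ^ k) ^ n := by rw [← pow_mul, ← pow_mul, mul_comm]
  rw [h3, mul_neg, Real.exp_neg]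
  set x := t ^ k
  have hx : 0 < x := by positivity
  rw [div_le_iff₀ (by positivity)] at h2
  rw [div_le_iff₀ (by positivity), inv_le_iff_one_le_mul₀ (by positivity)]
  have h4 : 1 ≤ (2 ^ n) ^ k * x ^ n * (k * (1 / 2 * x⁻¹)) ^ n := by
    rw [← pow_mul, mul_comm n k, pow_mul, ← mul_pow, ← mul_pow]
    refine one_le_pow₀ ?_
    have : (2 : ℝ) ^ k * x * (k * (1 / 2 * x⁻¹)) = 2 ^ k / 2 * k := by field_simp
    rw [this]
    have : (1 : ℝ) ≤ k := by exact_mod_cast hk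
    have : (2 : ℝ) ≤ 2 ^ k := by
      simpa using pow_le_pow_right₀ (one_le_two : (1 : ℝ) ≤ 2) hk
    nlinarith
  calc (1 : ℝ) ≤ (2 ^ n) ^ k * x ^ n * (k * (1 / 2 * x⁻¹)) ^ n := h4
    _ ≤ (2 ^ n) ^ k * x ^ n * (Real.exp (k * (1 / 2 * x⁻¹)) * n.factorial) := by gcongr
    _ = _ := by ring

theorem exists_isGevreyJet_flatJet {k : ℕ} (hk : 0 < k) {s : ℝ} (hs : 1 + 1 / k ≤ s) :
    ∃ A : ℝ, 0 < A ∧ IsGevreyJet s 1 A (flatJet k) Set.univ := by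
  obtain ⟨ρ, hρ, h⟩ := exists_norm_iteratedDeriv_flatExp_le k
  refine ⟨2 / ρ, by positivity, fun n t _ => ?_⟩
  unfold flatJet
  split_ifs with ht
  · refine (Complex.abs_re_le_norm _).trans ((h n t ht).trans ?_)
    have h1 := exp_mul_inv_pow_le hk n ht
    calc n.factorial * Real.exp (-(1 / 2 * (t ^ k)⁻¹)) / (ρ * t) ^ n
        = n.factorial / ρ ^ n * (Real.exp (-(1 / 2 * (t ^ k)⁻¹)) / t ^ n) := by
          rw [mul_pow]; field_simp
      _ ≤ n.factorial / ρ ^ n * ((n.factorial : ℝ) ^ (1 / k : ℝ) * 2 ^ n) := by gcongr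
      _ = (n.factorial : ℝ) ^ (1 + 1 / k : ℝ) * (2 / ρ) ^ n := by
          rw [Real.rpow_add (by positivity), Real.rpow_one, div_pow]; ring
      _ ≤ _ := by
          rw [one_mul]
          gcongr
          exact_mod_cast Nat.one_le_iff_ne_zero.2 n.factorial_ne_zero
  · rw [abs_zero]; positivity

theorem isJet_flatJet {k : ℕ} (hk : 0 < k) : IsJet Set.univ (flatJet k) := by
  intro n t _
  rcases lt_trichotomy t 0 with ht | rfl | ht
  · have h0 : flatJet k (n + 1) t = 0 := if_neg ht.not_gt
    rw [h0]
    refine (hasDerivAt_const t (0 : ℝ)).congr_of_eventuallyEq ?_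
    filter_upwards [gt_mem_nhds ht] with r hr using if_neg (not_lt.2 hr.le)
  · obtain ⟨ρ, hρ, h⟩ := exists_norm_iteratedDeriv_flatExp_le k
    have h0 : ∀ m, flatJet k m 0 = 0 := fun m => if_neg (lt_irrefl _)
    rw [h0, hasDerivAt_iff_isLittleO, h0]
    simp only [sub_zero, smul_zero]
    -- Using the decay with exponent n + 2 instead of n leaves a factor r², so the n-th derivative
    -- is o(r) at 0.
    set C := n.factorial / ρ ^ n * (((n + 2).factorial : ℝ) ^ (1 / k : ℝ) * 2 ^ (n + 2))
    have hb : ∀ r : ℝ, ‖flatJet k n r‖ ≤ C * ‖r ^ 2‖ := by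
      intro r
      unfold flatJet
      split_ifs with hr
      · refine (Complex.abs_re_le_norm _).trans ((h n r hr).trans ?_)
        have h1 := exp_mul_inv_pow_le hk (n + 2) hr
        calc n.factorial * Real.exp (-(1 / 2 * (r ^ k)⁻¹)) / (ρ * r) ^ n
            = n.factorial / ρ ^ n * (Real.exp (-(1 / 2 * (r ^ k)⁻¹)) / r ^ (n + 2)) * r ^ 2 := by
              rw [mul_pow, pow_add]; field_simp
          _ ≤ C * r ^ 2 := by simp only [C]; gcongr
          _ = _ := by rw [Real.norm_of_nonneg (by positivity)]
      · rw [norm_zero]; positivity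
    refine (Asymptotics.IsBigO.of_bound C (Filter.Eventually.of_forall hb)).trans_isLittleO ?_
    exact Asymptotics.isLittleO_pow_id one_lt_two
  · have h1 := (hasDerivAt_iteratedDeriv_flatExp k n (z := t)
      (by exact_mod_cast ht.ne')).real_of_complex
    have h0 : flatJet k (n + 1) t = (iteratedDeriv (n + 1) (flatExp k) t).re := if_pos ht
    rw [h0]
    refine h1.congr_of_eventuallyEq ?_
    filter_upwards [lt_mem_nhds ht] with r hr using if_pos hr

theorem flatJet_of_nonpos (k n : ℕ) {t : ℝ} (ht : t ≤ 0) : flatJet k n t = 0 :=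
  if_neg ht.not_gt

theorem flatJet_zero_pos (k : ℕ) {t : ℝ} (ht : 0 < t) : 0 < flatJet k 0 t := by
  rw [flatJet, if_pos ht, iteratedDeriv_zero, flatExp, ← Complex.ofReal_pow, ← Complex.ofReal_inv,
    ← Complex.ofReal_neg, ← Complex.ofReal_exp, Complex.ofReal_re]
  exact Real.exp_pos _

/-! ### Gevrey bumps and steps -/

/-- The derivatives of a bump function supported in `[τ, T]`. -/
noncomputable def bumpJet (k : ℕ) (τ T : ℝ) : ℕ → ℝ → ℝ :=
  leibniz (fun n t => flatJet k n (t - τ)) (fun n t => (-1) ^ n * flatJet k n (T - t))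

theorem isJet_bumpJet {k : ℕ} (hk : 0 < k) (τ T : ℝ) : IsJet Set.univ (bumpJet k τ T) := by
  refine IsJet.leibniz (fun n t _ => ?_) (fun n t _ => ?_)
  · exact (isJet_flatJet hk n (t - τ) trivial).comp_sub_const t τ
  · have h := ((isJet_flatJet hk n (T - t) trivial).comp_const_sub T t).const_mul ((-1) ^ n)
    refine h.congr_deriv ?_
    simp only [pow_succ]
    ring

theorem exists_isGevreyJet_bumpJet {k : ℕ} (hk : 0 < k) {s : ℝ} (hs : 1 + 1 / k ≤ s) (τ T : ℝ) :
    ∃ A : ℝ, 0 < A ∧ IsGevreyJet s 1 A (bumpJet k τ T) Set.univ := by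
  obtain ⟨A, hA, h⟩ := exists_isGevreyJet_flatJet hk hs
  have hs0 : 0 ≤ s := le_trans (by positivity) hs
  refine ⟨A + A, by positivity, ?_⟩
  have := IsGevreyJet.leibniz (a := fun n t => flatJet k n (t - τ))
    (b := fun n t => (-1) ^ n * flatJet k n (T - t)) (S := Set.univ) hs0 zero_le_one hA.le
    zero_le_one hA.le (fun n t _ => h n (t - τ) trivial) (fun n t _ => ?_)
  · rwa [one_mul] at this
  · rw [abs_mul, abs_pow, abs_neg, abs_one, one_pow, one_mul]
    exact h n (T - t) trivial

theorem bumpJet_of_le (k : ℕ) {τ : ℝ} (T : ℝ) (n : ℕ) {t : ℝ} (ht : t ≤ τ) :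
    bumpJet k τ T n t = 0 := by
  unfold bumpJet leibniz
  exact Finset.sum_eq_zero fun ij _ => by
    simp [flatJet_of_nonpos k _ (sub_nonpos.2 ht)]

theorem bumpJet_of_ge (k : ℕ) (τ : ℝ) {T : ℝ} (n : ℕ) {t : ℝ} (ht : T ≤ t) :
    bumpJet k τ T n t = 0 := by
  unfold bumpJet leibniz
  exact Finset.sum_eq_zero fun ij _ => by
    simp [flatJet_of_nonpos k _ (sub_nonpos.2 ht)]

theorem bumpJet_zero_pos (k : ℕ) {τ T t : ℝ} (h1 : τ < t) (h2 : t < T) : 0 < bumpJet k τ T 0 t := by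
  simpa [bumpJet, leibniz] using
    mul_pos (flatJet_zero_pos k (sub_pos.2 h1)) (flatJet_zero_pos k (sub_pos.2 h2))

/-- There are Gevrey functions of any order `s > 1` which are `1` before `τ` and `0` after `T`. -/
theorem exists_gevrey_step {τ T s : ℝ} (hτT : τ < T) (hs : 1 < s) : ∃ (φ : ℕ → ℝ → ℝ) (M A : ℝ),
    0 < M ∧ 0 < A ∧ IsJet Set.univ φ ∧ IsGevreyJet s M A φ Set.univ ∧
    (∀ t ≤ τ, φ 0 t = 1) ∧ (∀ n, ∀ t ≤ τ, φ (n + 1) t = 0) ∧ (∀ n, ∀ t ≥ T, φ n t = 0) := by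
  -- A large k brings the order 1 + 1/k of the flat function below s.
  obtain ⟨m, hm⟩ := exists_nat_one_div_lt (sub_pos.2 hs)
  set k := m + 1
  have hk : 0 < k := m.succ_pos
  have hks : (1 + 1 / (k : ℝ)) ≤ s := by simp only [k]; push_cast; linarith
  set b := bumpJet k τ T
  have hb : IsJet Set.univ b := isJet_bumpJet hk τ T
  obtain ⟨A, hA, hbA⟩ := exists_isGevreyJet_bumpJet hk hks τ T
  have hbc : Continuous (b 0) := continuous_iff_continuousAt.2 fun t => hb.continuousAt 0 trivial
  set I := ∫ r in τ..T, b 0 r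
  have hI : 0 < I := intervalIntegral.intervalIntegral_pos_of_pos_on (hbc.intervalIntegrable _ _)
    (fun x hx => bumpJet_zero_pos k hx.1 hx.2) hτT
  -- One minus the normalized primitive of the bump: from order one on, the jet is that of the bump
  -- shifted by one.
  set φ : ℕ → ℝ → ℝ := fun n t => match n with
    | 0 => 1 - (∫ r in τ..t, b 0 r) / I
    | n + 1 => -(b n t / I)
  have hφ : IsJet Set.univ φ := by
    intro n t _
    cases n with
    | zero =>
      exact ((hbc.integral_hasStrictDerivAt τ t).hasDerivAt.div_const I).const_sub 1
    | succ n => exact ((hb n t trivial).div_const I).neg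
  have h0 : ∀ t ≤ τ, φ 0 t = 1 := by
    intro t ht
    have : ∫ r in τ..t, b 0 r = 0 := by
      rw [intervalIntegral.integral_congr (g := fun _ => (0 : ℝ)), intervalIntegral.integral_zero]
      intro r hr
      rw [Set.uIcc_of_ge ht] at hr
      exact bumpJet_of_le k T 0 hr.2
    simp only [φ, this]; ring
  have hT : ∀ n, ∀ t ≥ T, φ n t = 0 := by
    intro n t ht
    cases n with
    | zero =>
      have h1 : ∫ r in T..t, b 0 r = 0 := by
        rw [intervalIntegral.integral_congr (g := fun _ => (0 : ℝ)), intervalIntegral.integral_zero]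
        intro r hr
        rw [Set.uIcc_of_le ht] at hr
        exact bumpJet_of_ge k τ 0 hr.1
      have h2 := intervalIntegral.integral_add_adjacent_intervals
        (hbc.intervalIntegrable (μ := MeasureTheory.volume) τ T) (hbc.intervalIntegrable T t)
      rw [h1, add_zero] at h2
      simp only [φ, ← h2]
      rw [div_self hI.ne', sub_self]
    | succ n => simp only [φ, b, bumpJet_of_ge k τ n ht]; simp
  obtain ⟨K, hK⟩ := isCompact_Icc.exists_bound_of_continuousOn (s := Set.Icc τ T) (f := φ 0)
    fun t _ => (hφ.continuousAt 0 trivial).continuousWithinAt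
  -- K and 1 bound the order-zero term, 1/I the others; replacing A by max A 1 absorbs the shift
  -- from Aⁿ to the power n + 1.
  refine ⟨φ, max (max K 1) (1 / I), max A 1, by positivity, by positivity, hφ, ?_, h0, ?_, hT⟩
  · intro n t _
    cases n with
    | zero =>
      simp only [Nat.factorial_zero, Nat.cast_one, Real.one_rpow, mul_one, pow_zero]
      refine le_trans ?_ (le_max_left _ _)
      rcases le_total t τ with h | h
      · rw [h0 t h, abs_one]; exact le_max_right _ _
      rcases le_total T t with h' | h'
      · rw [hT 0 t h', abs_zero]; positivity
      · exact (hK t ⟨h, h'⟩).trans (le_max_left _ _)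
    | succ n =>
      have h1 := hbA n t trivial
      calc |φ (n + 1) t| = 1 / I * |b n t| := by
            simp only [φ]; rw [abs_neg, abs_div, abs_of_pos hI]; ring
        _ ≤ 1 / I * (1 * (n.factorial : ℝ) ^ s * A ^ n) := by gcongr
        _ ≤ max (max K 1) (1 / I) * (((n + 1).factorial : ℝ) ^ s * max A 1 ^ (n + 1)) := by
            rw [one_mul]
            gcongr ?_ * (?_ * ?_)
            · exact le_max_right _ _
            · gcongr; exact n.le_succ
            · calc A ^ n ≤ max A 1 ^ n := by gcongr; exact le_max_left _ _
                _ ≤ _ := pow_le_pow_right₀ (le_max_right _ _) n.le_succ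
        _ = _ := by ring
  · intro n t ht
    simp only [φ, b, bumpJet_of_le k T n ht]; simp

/-! ### The flat series: convergence, smoothness and Gevrey bounds -/

/-- Partial derivatives that exist and are continuous to all orders give a smooth function. -/
theorem contDiffOn_of_hasDerivAt_partial {U : Set (ℝ × ℝ)} (hU : IsOpen U)
    {G : ℕ → ℕ → ℝ → ℝ → ℝ}
    (hc : ∀ p q, ContinuousOn (fun z : ℝ × ℝ => G p q z.1 z.2) U)
    (ht : ∀ p q, ∀ z ∈ U, HasDerivAt (fun t => G p q t z.2) (G (p + 1) q z.1 z.2) z.1)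
    (hx : ∀ p q, ∀ z ∈ U, HasDerivAt (fun x => G p q z.1 x) (G p (q + 1) z.1 z.2) z.2) (p q : ℕ) :
    ContDiffOn ℝ ((⊤ : ℕ∞) : WithTop ℕ∞) (fun z : ℝ × ℝ => G p q z.1 z.2) U := by
  rw [contDiffOn_infty]
  intro n
  induction n generalizing p q with
  | zero => exact contDiffOn_zero.2 (hc p q)
  | succ n ih =>
    push_cast
    rw [contDiffOn_succ_iff_hasFDerivWithinAt_of_uniqueDiffOn hU.uniqueDiffOn]
    refine ⟨by simp, fun z => (ContinuousLinearMap.toSpanSingleton ℝ (G (p + 1) q z.1 z.2)).coprod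
      (ContinuousLinearMap.toSpanSingleton ℝ (G p (q + 1) z.1 z.2)), ?_, fun z hz => ?_⟩
    -- The total derivative is a combination of two constant linear maps with coefficients in the
    -- family `G`, so the induction hypothesis applies to it.
    · have h : ∀ z : ℝ × ℝ, (ContinuousLinearMap.toSpanSingleton ℝ (G (p + 1) q z.1 z.2)).coprod
          (ContinuousLinearMap.toSpanSingleton ℝ (G p (q + 1) z.1 z.2)) =
          G (p + 1) q z.1 z.2 • ContinuousLinearMap.fst ℝ ℝ ℝ +
          G p (q + 1) z.1 z.2 • ContinuousLinearMap.snd ℝ ℝ ℝ := by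
        intro z
        ext <;> simp
      simp only [h]
      exact ((ih (p + 1) q).smul contDiffOn_const).add ((ih p (q + 1)).smul contDiffOn_const)
    · have hcont : ∀ p q, ContinuousAt
          (fun z : ℝ × ℝ => ContinuousLinearMap.toSpanSingleton ℝ (G p q z.1 z.2)) z := by
        intro p q
        have := (ContinuousLinearMap.toSpanSingletonCLE
          (𝕜 := ℝ) (E := ℝ)).continuous.continuousAt.comp
          ((hc p q).continuousAt (hU.mem_nhds hz))
        exact this
      have h := hasStrictFDerivAt_uncurry_coprod (𝕜 := ℝ) (u := z) (f := G p q)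
        (f₁ := fun t x => ContinuousLinearMap.toSpanSingleton ℝ (G (p + 1) q t x))
        (f₂ := fun t x => ContinuousLinearMap.toSpanSingleton ℝ (G p (q + 1) t x))
        (by filter_upwards [hU.mem_nhds hz] with v hv using (ht p q v hv).hasFDerivAt)
        (by filter_upwards [hU.mem_nhds hz] with v hv using (hx p q v hv).hasFDerivAt)
        (hcont (p + 1) q) (hcont p (q + 1))
      exact h.hasFDerivAt.hasFDerivWithinAt

/-- The Taylor coefficients in `x` at `x = 0` of the solution with flat output `y`, differentiated
`p` times in time. -/
noncomputable def evenCoeff (y : ℕ → ℝ → ℝ) (p m : ℕ) (t : ℝ) : ℝ :=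
  if Even m then y (m / 2 + p) t else 0

/-- The partial derivative `∂ₜᵖ ∂ₓ^q` of the solution `∑ x²ⁱ y⁽ⁱ⁾(t) / (2i)!` of the heat equation
with flat output `y`. -/
noncomputable def flatSeries (y : ℕ → ℝ → ℝ) (p q : ℕ) (t x : ℝ) : ℝ :=
  ∑' j : ℕ, x ^ j / j.factorial * evenCoeff y p (j + q) t

/-- The weights majorizing the terms of `flatSeries`. -/
noncomputable def flatWeight (s c X : ℝ) (j : ℕ) : ℝ :=
  X ^ j / j.factorial * ((j.factorial : ℝ) ^ (s / 2) * (2 * c) ^ j)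

/-- This is the heat equation, here an identity term by term that needs no convergence: raising the
Taylor index by two raises the order of the derivative of y by one. -/
theorem flatSeries_add_two (y : ℕ → ℝ → ℝ) (p q : ℕ) :
    flatSeries y p (q + 2) = flatSeries y (p + 1) q := by
  ext t x
  unfold flatSeries
  congr 1
  ext j
  congr 1
  unfold evenCoeff
  have h1 : (j + (q + 2)) / 2 + p = (j + q) / 2 + (p + 1) := by omega
  have h2 : Even (j + (q + 2)) ↔ Even (j + q) := by
    rw [← add_assoc, Nat.even_add]; simp
  simp only [h1, h2]

/-- The ratio of consecutive weights is 2cX (j+1)^(s/2-1), which tends to 0 exactly because s < 2.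
-/
theorem summable_flatWeight {s c X : ℝ} (hs : s < 2) (hc : 0 < c) (hX : 0 < X) :
    Summable (flatWeight s c X) := by
  have hpos : ∀ j, 0 < flatWeight s c X j := fun j => by unfold flatWeight; positivity
  refine summable_of_ratio_test_tendsto_lt_one (l := 0) one_pos
    (Filter.Eventually.of_forall fun j => (hpos j).ne') ?_
  have h : ∀ j : ℕ, ‖flatWeight s c X (j + 1)‖ / ‖flatWeight s c X j‖ =
      2 * c * X * (((j : ℝ) + 1)) ^ (-(1 - s / 2)) := by
    intro j
    rw [Real.norm_of_nonneg (hpos _).le, Real.norm_of_nonneg (hpos _).le]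
    unfold flatWeight
    rw [Nat.factorial_succ]
    push_cast
    rw [Real.mul_rpow (by positivity) (by positivity), neg_sub, Real.rpow_sub (by positivity),
      Real.rpow_one]
    field_simp
    ring
  simp only [h]
  rw [← mul_zero (2 * c * X)]
  refine Filter.Tendsto.const_mul _ ?_
  refine (tendsto_rpow_neg_atTop (by linarith : 0 < 1 - s / 2)).comp ?_
  exact Filter.tendsto_atTop_add_const_right _ _ tendsto_natCast_atTop_atTop

theorem factorial_add_rpow_le {r : ℝ} (hr : 0 ≤ r) (m n : ℕ) : ((m + n).factorial : ℝ) ^ r ≤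
    ((2 : ℝ) ^ r) ^ (m + n) * ((m.factorial : ℝ) ^ r * (n.factorial : ℝ) ^ r) := by
  have h : ((m + n).factorial : ℝ) ≤ 2 ^ (m + n) * (m.factorial * n.factorial) := by
    rw [← Nat.add_choose_mul_factorial_mul_factorial m n, mul_assoc]
    push_cast
    gcongr
    exact_mod_cast Nat.choose_le_two_pow _ _
  calc ((m + n).factorial : ℝ) ^ r ≤ (2 ^ (m + n) * (m.factorial * n.factorial) : ℝ) ^ r := by
        gcongr
    _ = _ := by
        rw [Real.mul_rpow (by positivity) (by positivity),
          Real.mul_rpow (by positivity) (by positivity), ← Real.rpow_natCast, ← Real.rpow_natCast,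
          ← Real.rpow_mul (by norm_num), ← Real.rpow_mul (by norm_num), mul_comm r]

/-- For j + q = 2i, (i!)^s = (i! i!)^(s/2) ≤ ((j+q)!)^(s/2), which is where the order s/2 in x
arises. The factorials of i + p and j + q are then split at the cost of powers of 2, separating p, q
and j. -/
theorem abs_evenCoeff_le {s M A : ℝ} {y : ℕ → ℝ → ℝ} {S : Set ℝ} (hs : 0 ≤ s) (hs2 : s < 2)
    (hM : 0 ≤ M) (hA : 1 ≤ A) (hy : IsGevreyJet s M A y S) (p q j : ℕ) {t : ℝ} (ht : t ∈ S) :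
    |evenCoeff y p (j + q) t| ≤ M * ((p.factorial : ℝ) ^ s * (q.factorial : ℝ) ^ (s / 2)) *
      ((2 ^ s * A) ^ p * (2 * (2 ^ s * A)) ^ q) *
      ((j.factorial : ℝ) ^ (s / 2) * (2 * (2 ^ s * A)) ^ j) := by
  have hA0 : 0 < A := by linarith
  set c := (2 : ℝ) ^ s * A
  have h2s : (1 : ℝ) ≤ 2 ^ s := Real.one_le_rpow (by norm_num) hs
  have hc : 1 ≤ c := by simp only [c]; nlinarith
  unfold evenCoeff
  split_ifs with he
  · obtain ⟨i, hi⟩ := he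
    have hi2 : (j + q) / 2 = i := by omega
    rw [hi2]
    have h1 : (i.factorial : ℝ) ^ s ≤ ((j + q).factorial : ℝ) ^ (s / 2) := by
      calc (i.factorial : ℝ) ^ s = ((i.factorial * i.factorial : ℕ) : ℝ) ^ (s / 2) := by
            push_cast
            rw [← pow_two, ← Real.rpow_natCast, ← Real.rpow_mul (by positivity)]
            congr 1; push_cast; ring
        _ ≤ _ := by
            gcongr
            rw [hi]
            exact_mod_cast Nat.le_of_dvd (Nat.factorial_pos _)
              (Nat.factorial_mul_factorial_dvd_factorial_add i i)
    have h2 : ((j + q).factorial : ℝ) ^ (s / 2) ≤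
        2 ^ (j + q) * ((j.factorial : ℝ) ^ (s / 2) * (q.factorial : ℝ) ^ (s / 2)) := by
      refine (factorial_add_rpow_le (by linarith) j q).trans ?_
      gcongr
      calc (2 : ℝ) ^ (s / 2) ≤ 2 ^ (1 : ℝ) := by
            apply Real.rpow_le_rpow_of_exponent_le <;> linarith
        _ = 2 := Real.rpow_one 2
    calc |y (i + p) t| ≤ M * ((i + p).factorial : ℝ) ^ s * A ^ (i + p) := hy _ t ht
      _ ≤ M * ((2 ^ s) ^ (i + p) * ((i.factorial : ℝ) ^ s * (p.factorial : ℝ) ^ s)) *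
            A ^ (i + p) := by
          gcongr
          exact factorial_add_rpow_le hs i p
      _ = M * (i.factorial : ℝ) ^ s * (p.factorial : ℝ) ^ s * (c ^ i * c ^ p) := by
          simp only [c, mul_pow, pow_add]; ring
      _ ≤ M * (2 ^ (j + q) * ((j.factorial : ℝ) ^ (s / 2) * (q.factorial : ℝ) ^ (s / 2))) *
            (p.factorial : ℝ) ^ s * (c ^ (j + q) * c ^ p) := by
          gcongr
          · exact h1.trans h2
          · omega
      _ = _ := by rw [mul_pow, mul_pow, pow_add, pow_add]; ring
  · rw [abs_zero]; positivity

/-- The majorant does not depend on t in S or on |x| ≤ X; it serves every termwise differentiation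
and continuity argument for the flat series. -/
theorem norm_flatSeries_term_le {s M A X : ℝ} {y : ℕ → ℝ → ℝ} {S : Set ℝ} (hs : 0 ≤ s)
    (hs2 : s < 2) (hM : 0 ≤ M) (hA : 1 ≤ A) (hy : IsGevreyJet s M A y S) (p q j : ℕ)
    {t x : ℝ} (ht : t ∈ S) (hx : |x| ≤ X) :
    ‖x ^ j / j.factorial * evenCoeff y p (j + q) t‖ ≤
      M * ((p.factorial : ℝ) ^ s * (q.factorial : ℝ) ^ (s / 2)) *
      ((2 ^ s * A) ^ p * (2 * (2 ^ s * A)) ^ q) * flatWeight s (2 ^ s * A) X j := by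
  have h := abs_evenCoeff_le hs hs2 hM hA hy p q j ht
  have hX : 0 ≤ X := (abs_nonneg x).trans hx
  rw [norm_mul, norm_div, norm_pow, Real.norm_natCast, Real.norm_eq_abs, Real.norm_eq_abs]
  refine (mul_le_mul (?_ : _ ≤ X ^ j / (j.factorial : ℝ)) h (abs_nonneg _)
    (by positivity)).trans_eq ?_
  · gcongr
  · unfold flatWeight; ring

/-- A sequence of functions with the bounds that make `flatSeries` converge. -/
structure IsFlatOutput (s M A a : ℝ) (y : ℕ → ℝ → ℝ) : Prop where
  order_nonneg : 0 ≤ s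
  order_lt : s < 2
  M_nonneg : 0 ≤ M
  one_le : 1 ≤ A
  jet : IsJet (Set.Ioi a) y
  gevrey : IsGevreyJet s M A y (Set.Ioi a)

namespace IsFlatOutput

variable {s M A a : ℝ} {y : ℕ → ℝ → ℝ}

theorem summable_bound (h : IsFlatOutput s M A a y) {X : ℝ} (hX : 0 < X) (C : ℝ) :
    Summable fun j => C * flatWeight s (2 ^ s * A) X j :=
  (summable_flatWeight h.order_lt (by have := h.one_le; positivity) hX).mul_left C

theorem summable_term (h : IsFlatOutput s M A a y) (p q : ℕ) {t : ℝ} (ht : a < t) (x : ℝ) :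
    Summable fun j : ℕ => x ^ j / j.factorial * evenCoeff y p (j + q) t :=
  Summable.of_norm_bounded (h.summable_bound (X := |x| + 1) (by positivity) _) fun j =>
    norm_flatSeries_term_le h.order_nonneg h.order_lt h.M_nonneg h.one_le h.gevrey p q j ht
      (by linarith)

theorem hasDerivAt_time (h : IsFlatOutput s M A a y) (p q : ℕ) {t : ℝ} (ht : a < t) (x : ℝ) :
    HasDerivAt (fun t => flatSeries y p q t x) (flatSeries y (p + 1) q t x) t := by
  refine hasDerivAt_tsum_of_isPreconnected
    (g := fun (j : ℕ) t => x ^ j / j.factorial * evenCoeff y p (j + q) t)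
    (g' := fun (j : ℕ) t => x ^ j / j.factorial * evenCoeff y (p + 1) (j + q) t)
    (h.summable_bound (X := |x| + 1) (by positivity) _)
    isOpen_Ioi isPreconnected_Ioi (fun j r hr => ?_) (fun j r hr => norm_flatSeries_term_le
      h.order_nonneg h.order_lt h.M_nonneg h.one_le h.gevrey (p + 1) q j hr (by linarith))
    ht (h.summable_term p q ht x) ht
  refine HasDerivAt.const_mul _ ?_
  unfold evenCoeff
  split_ifs
  · exact h.jet _ r hr
  · exact hasDerivAt_const _ _

theorem hasDerivAt_space (h : IsFlatOutput s M A a y) (p q : ℕ) {t : ℝ} (ht : a < t) (x : ℝ) :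
    HasDerivAt (fun x => flatSeries y p q t x) (flatSeries y p (q + 1) t x) x := by
  set C := M * ((p.factorial : ℝ) ^ s * ((q + 1).factorial : ℝ) ^ (s / 2)) *
      ((2 ^ s * A) ^ p * (2 * (2 ^ s * A)) ^ (q + 1))
  set X := |x| + 1
  have hX : 0 < X := by positivity
  have hderiv : ∀ (j : ℕ) (r : ℝ), HasDerivAt
      (fun r => r ^ j / (j.factorial : ℝ) * evenCoeff y p (j + q) t)
      (j * r ^ (j - 1) / (j.factorial : ℝ) * evenCoeff y p (j + q) t) r := fun j r =>
    ((hasDerivAt_pow j r).div_const _).mul_const _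
  have hsucc : ∀ (j : ℕ) (r : ℝ), ((j + 1 : ℕ) : ℝ) * r ^ (j + 1 - 1) / ((j + 1).factorial : ℝ) *
      evenCoeff y p (j + 1 + q) t = r ^ j / j.factorial * evenCoeff y p (j + (q + 1)) t := by
    intro j r
    rw [show j + 1 + q = j + (q + 1) by ring, Nat.factorial_succ, Nat.add_sub_cancel]
    push_cast
    field_simp
  -- The term of index 0 is constant in x, and the derivative of the term j + 1 is the term j of the
  -- series for q + 1; hence the shifted majorant.
  have hu : Summable fun j : ℕ => match j with
      | 0 => (0 : ℝ)
      | j + 1 => C * flatWeight s (2 ^ s * A) X j := by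
    rw [← summable_nat_add_iff 1]
    exact h.summable_bound hX C
  have hx : x ∈ Metric.ball (0 : ℝ) X := by simp [X]
  have key := hasDerivAt_tsum_of_isPreconnected hu Metric.isOpen_ball
    (convex_ball (0 : ℝ) X).isPreconnected (fun j r _ => hderiv j r) (fun j r hr => ?_) hx
    (h.summable_term p q ht x) hx
  · refine key.congr_deriv ?_
    have hs : Summable fun j : ℕ =>
        j * x ^ (j - 1) / (j.factorial : ℝ) * evenCoeff y p (j + q) t := by
      rw [← summable_nat_add_iff 1]
      simp only [hsucc]
      exact h.summable_term p (q + 1) ht x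
    rw [hs.tsum_eq_zero_add]
    simp only [hsucc]
    simp [flatSeries]
  · cases j with
    | zero => simp
    | succ j =>
      rw [hsucc]
      rw [Metric.mem_ball, dist_zero_right, Real.norm_eq_abs] at hr
      exact norm_flatSeries_term_le h.order_nonneg h.order_lt h.M_nonneg h.one_le h.gevrey p
        (q + 1) j ht hr.le

theorem continuousOn_flatSeries (h : IsFlatOutput s M A a y) (p q : ℕ) :
    ContinuousOn (fun z : ℝ × ℝ => flatSeries y p q z.1 z.2) (Set.Ioi a ×ˢ Set.univ) := by
  intro z hz
  have hz1 : a < z.1 := hz.1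
  set X := |z.2| + 1
  have hX : 0 < X := by positivity
  have hc : ContinuousOn (fun z : ℝ × ℝ => flatSeries y p q z.1 z.2)
      (Set.Ioi a ×ˢ Metric.ball (0 : ℝ) X) := by
    refine continuousOn_tsum (fun j => ?_) (h.summable_bound hX _) (fun j w hw => ?_)
      (u := fun j => M * ((p.factorial : ℝ) ^ s * (q.factorial : ℝ) ^ (s / 2)) *
      ((2 ^ s * A) ^ p * (2 * (2 ^ s * A)) ^ q) * flatWeight s (2 ^ s * A) X j)
    · refine ContinuousOn.mul (by fun_prop) ?_
      unfold evenCoeff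
      split_ifs
      · intro w hw
        have := (h.jet.continuousAt ((j + q) / 2 + p) (t := w.1) hw.1).comp (x := w)
          continuous_fst.continuousAt
        exact this.continuousWithinAt
      · exact continuousOn_const
    · refine norm_flatSeries_term_le h.order_nonneg h.order_lt h.M_nonneg h.one_le h.gevrey p
        q j hw.1 ?_
      have := hw.2
      rw [Metric.mem_ball, dist_zero_right, Real.norm_eq_abs] at this
      exact this.le
  refine (hc.continuousAt ?_).continuousWithinAt
  refine prod_mem_nhds (Ioi_mem_nhds hz1) (Metric.isOpen_ball.mem_nhds ?_)
  simp [X]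

theorem contDiffOn_flatSeries (h : IsFlatOutput s M A a y) (p q : ℕ) :
    ContDiffOn ℝ ((⊤ : ℕ∞) : WithTop ℕ∞) (fun z : ℝ × ℝ => flatSeries y p q z.1 z.2)
      (Set.Ioi a ×ˢ Set.univ) :=
  contDiffOn_of_hasDerivAt_partial (isOpen_Ioi.prod isOpen_univ) h.continuousOn_flatSeries
    (fun p q _ hz => h.hasDerivAt_time p q hz.1 _) (fun p q _ hz => h.hasDerivAt_space p q hz.1 _)
    p q

theorem abs_flatSeries_le (h : IsFlatOutput s M A a y) {X : ℝ} (hX : 0 < X) (p q : ℕ) {t x : ℝ}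
    (ht : a < t) (hx : |x| ≤ X) : |flatSeries y p q t x| ≤
      M * ((p.factorial : ℝ) ^ s * (q.factorial : ℝ) ^ (s / 2)) *
      ((2 ^ s * A) ^ p * (2 * (2 ^ s * A)) ^ q) * ∑' j, flatWeight s (2 ^ s * A) X j := by
  rw [← tsum_mul_left]
  exact tsum_of_norm_bounded (h.summable_bound hX _).hasSum fun j =>
    norm_flatSeries_term_le h.order_nonneg h.order_lt h.M_nonneg h.one_le h.gevrey p q j ht hx

theorem iteratedDeriv_flatSeries (h : IsFlatOutput s M A a y) (p q : ℕ) {t : ℝ} (ht : a < t)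
    (x : ℝ) : iteratedDeriv p
      (fun t => iteratedDeriv q (fun x => flatSeries y 0 0 t x) x) t = flatSeries y p q t x := by
  have h1 : ∀ r ∈ Set.Ioi a, iteratedDeriv q (fun x => flatSeries y 0 0 r x) x =
      flatSeries y 0 q r x := fun r hr =>
    IsJet.iteratedDeriv_eq isOpen_univ (a := fun q x => flatSeries y 0 q r x)
      (fun q x _ => h.hasDerivAt_space 0 q hr x) q x trivial
  have h2 : (fun t => iteratedDeriv q (fun x => flatSeries y 0 0 t x) x) =ᶠ[nhds t]
      fun t => flatSeries y 0 q t x := by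
    filter_upwards [Ioi_mem_nhds ht] with r hr using h1 r hr
  rw [h2.iteratedDeriv_eq]
  exact IsJet.iteratedDeriv_eq isOpen_Ioi (a := fun p t => flatSeries y p q t x)
    (fun p t ht => h.hasDerivAt_time p q ht x) p t ht

theorem gevreyOn₂ (h : IsFlatOutput s M A a y) {θ : ℝ → ℝ → ℝ} {K : Set (ℝ × ℝ)} {X : ℝ}
    (hX : 0 < X) (hK : ∀ z ∈ K, a < z.1 ∧ |z.2| ≤ X)
    (hθ : ∀ z ∈ K, θ z.1 z.2 = flatSeries y 0 0 z.1 z.2) : GevreyOn₂ s (s / 2) θ K := by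
  have hA := h.one_le
  have hM := h.M_nonneg
  set c := (2 : ℝ) ^ s * A
  have hc : 0 < c := by positivity
  have hW : 0 ≤ ∑' j, flatWeight s c X j := tsum_nonneg fun j => by unfold flatWeight; positivity
  -- The summand 1 only makes the constant positive, as M may vanish.
  refine ⟨Set.Ioi a ×ˢ Set.univ, flatSeries y 0 0, isOpen_Ioi.prod isOpen_univ,
    fun z hz => ⟨(hK z hz).1, trivial⟩, h.contDiffOn_flatSeries 0 0, hθ,
    M * (∑' j, flatWeight s c X j) + 1, c⁻¹, (2 * c)⁻¹, by positivity, by positivity,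
    by positivity, fun p q z hz => ?_⟩
  rw [h.iteratedDeriv_flatSeries p q (hK z hz).1]
  refine (h.abs_flatSeries_le hX p q (hK z hz).1 (hK z hz).2).trans ?_
  rw [inv_pow, inv_pow, ← mul_inv, div_inv_eq_mul]
  calc _ = M * (∑' j, flatWeight s c X j) * ((p.factorial : ℝ) ^ s * (q.factorial : ℝ) ^ (s / 2)) *
        (c ^ p * (2 * c) ^ q) := by ring
    _ ≤ _ := by gcongr; linarith

end IsFlatOutput

/-! ### The output of the free evolution -/

/-- The `n`-th time derivative at `x = 0` of `∑ cₖ exp (-(kπ)² t) cos (kπx)`. -/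
noncomputable def freeJet (c : ℕ → ℝ) (n : ℕ) (t : ℝ) : ℝ :=
  ∑' k : ℕ, c k * (-(k * Real.pi) ^ 2) ^ n * Real.exp (-(k * Real.pi) ^ 2 * t)

theorem summable_exp_neg_sq {δ : ℝ} (hδ : 0 < δ) :
    Summable fun k : ℕ => Real.exp (-(k * Real.pi) ^ 2 * δ) := by
  have hg : Summable fun k : ℕ => Real.exp (-δ) ^ k :=
    summable_geometric_of_lt_one (Real.exp_pos _).le (by simpa using hδ)
  refine Summable.of_nonneg_of_le (fun k => (Real.exp_pos _).le) (fun k => ?_) hg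
  rw [← Real.exp_nat_mul, Real.exp_le_exp]
  have hk : (k : ℝ) ≤ (k * Real.pi) ^ 2 := by
    have h1 : (1 : ℝ) ≤ Real.pi ^ 2 := by nlinarith [Real.pi_gt_three]
    have h2 : (k : ℝ) ≤ (k : ℝ) ^ 2 := by exact_mod_cast Nat.le_self_pow two_ne_zero k
    rw [mul_pow]
    nlinarith
  nlinarith

/-- With l = (kπ)², half of the decay exp(-lδ) absorbs lⁿ at the price n! (2/δ)ⁿ, and the other half
remains for the sum over k. The single n! is what gives order 1. -/
theorem abs_freeJet_term_le {K : ℝ} {c : ℕ → ℝ} (hc : ∀ k, |c k| ≤ K) {δ : ℝ} (hδ : 0 < δ)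
    (n k : ℕ) {t : ℝ} (ht : δ ≤ t) :
    ‖c k * (-(k * Real.pi) ^ 2) ^ n * Real.exp (-(k * Real.pi) ^ 2 * t)‖ ≤
      K * (n.factorial * (2 / δ) ^ n) * Real.exp (-(k * Real.pi) ^ 2 * (δ / 2)) := by
  set l := ((k : ℝ) * Real.pi) ^ 2
  have hl : 0 ≤ l := by positivity
  have hK : 0 ≤ K := (abs_nonneg _).trans (hc k)
  have h1 : l ^ n ≤ n.factorial * (2 / δ) ^ n * Real.exp (l * (δ / 2)) := by
    have h := Real.pow_div_factorial_le_exp (x := l * (δ / 2)) (by positivity) n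
    rw [div_le_iff₀ (by positivity), mul_pow] at h
    have h3 : l ^ n = l ^ n * (δ / 2) ^ n * (2 / δ) ^ n := by
      rw [mul_assoc, ← mul_pow]
      field_simp
      simp
    rw [h3]
    calc _ ≤ (Real.exp (l * (δ / 2)) * n.factorial) * (2 / δ) ^ n := by gcongr
      _ = _ := by ring
  have h2 : Real.exp (-l * t) ≤ Real.exp (-l * (δ / 2)) * Real.exp (-l * (δ / 2)) := by
    rw [← Real.exp_add, Real.exp_le_exp]
    nlinarith
  have h4 : Real.exp (l * (δ / 2)) * Real.exp (-l * (δ / 2)) = 1 := by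
    rw [← Real.exp_add]; simp
  rw [norm_mul, norm_mul, norm_pow, norm_neg, Real.norm_of_nonneg hl,
    Real.norm_of_nonneg (Real.exp_pos _).le, Real.norm_eq_abs]
  calc |c k| * l ^ n * Real.exp (-l * t)
      ≤ K * (n.factorial * (2 / δ) ^ n * Real.exp (l * (δ / 2))) *
        (Real.exp (-l * (δ / 2)) * Real.exp (-l * (δ / 2))) := by
        gcongr
        exact hc k
    _ = K * (n.factorial * (2 / δ) ^ n) * (Real.exp (l * (δ / 2)) * Real.exp (-l * (δ / 2))) *
        Real.exp (-l * (δ / 2)) := by ring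
    _ = _ := by rw [h4, mul_one]

theorem summable_freeJet_term {K : ℝ} {c : ℕ → ℝ} (hc : ∀ k, |c k| ≤ K) (n : ℕ) {t : ℝ}
    (ht : 0 < t) : Summable fun k : ℕ =>
      c k * (-(k * Real.pi) ^ 2) ^ n * Real.exp (-(k * Real.pi) ^ 2 * t) :=
  Summable.of_norm_bounded ((summable_exp_neg_sq (half_pos ht)).mul_left _)
    fun k => abs_freeJet_term_le hc ht n k le_rfl

theorem isJet_freeJet {K : ℝ} {c : ℕ → ℝ} (hc : ∀ k, |c k| ≤ K) :
    IsJet (Set.Ioi 0) (freeJet c) := by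
  intro n t ht
  have ht : 0 < t := ht
  have htm : t ∈ Set.Ioi (t / 2) := half_lt_self ht
  refine hasDerivAt_tsum_of_isPreconnected
    (g := fun (k : ℕ) t => c k * (-(k * Real.pi) ^ 2) ^ n * Real.exp (-(k * Real.pi) ^ 2 * t))
    (g' := fun (k : ℕ) t =>
      c k * (-(k * Real.pi) ^ 2) ^ (n + 1) * Real.exp (-(k * Real.pi) ^ 2 * t))
    ((summable_exp_neg_sq (half_pos (half_pos ht))).mul_left _) isOpen_Ioi isPreconnected_Ioi
    (fun k r _ => ?_)
    (fun k r hr => abs_freeJet_term_le hc (half_pos ht) (n + 1) k (le_of_lt hr)) htm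
    (summable_freeJet_term hc n ht) htm
  have h := (((hasDerivAt_id r).const_mul (-(k * Real.pi) ^ 2)).exp).const_mul
    (c k * (-(k * Real.pi) ^ 2) ^ n)
  refine h.congr_deriv ?_
  simp only [id, pow_succ]
  ring

theorem exists_isGevreyJet_freeJet {K : ℝ} {c : ℕ → ℝ} (hc : ∀ k, |c k| ≤ K) {δ : ℝ}
    (hδ : 0 < δ) : ∃ M : ℝ, 0 ≤ M ∧ IsGevreyJet 1 M (2 / δ) (freeJet c) (Set.Ioi δ) := by
  have hK : 0 ≤ K := (abs_nonneg _).trans (hc 0)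
  refine ⟨K * ∑' k : ℕ, Real.exp (-(k * Real.pi) ^ 2 * (δ / 2)),
    mul_nonneg hK (tsum_nonneg fun k => (Real.exp_pos _).le), fun n t ht => ?_⟩
  have h := tsum_of_norm_bounded
    ((summable_exp_neg_sq (half_pos hδ)).mul_left (K * (n.factorial * (2 / δ) ^ n))).hasSum
    fun k => abs_freeJet_term_le hc hδ n k (le_of_lt ht)
  rw [tsum_mul_left] at h
  refine h.trans_eq ?_
  rw [Real.rpow_one]
  ring

theorem hasSum_cos_evenCoeff (l x : ℝ) (p : ℕ) :
    HasSum (fun j : ℕ => x ^ j / j.factorial * (if Even j then (-l ^ 2) ^ (j / 2 + p) else 0))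
      ((-l ^ 2) ^ p * Real.cos (l * x)) := by
  have hinj : Function.Injective fun i : ℕ => 2 * i := fun i j h => by simpa using h
  rw [← hinj.hasSum_iff]
  · refine ((Real.hasSum_cos (l * x)).mul_left ((-l ^ 2) ^ p)).congr_fun fun i => ?_
    have h1 : 2 * i / 2 = i := by omega
    simp only [Function.comp, even_two_mul, if_true, h1]
    rw [pow_add, neg_pow (l ^ 2) i, ← pow_mul, mul_pow]
    ring
  · intro j hj
    have : ¬ Even j := fun h => hj (by
      obtain ⟨i, hi⟩ := h
      exact ⟨i, by simp only; omega⟩)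
    rw [if_neg this, mul_zero]

/-- Each mode contributes the Taylor series of its cosine, so the claim is an exchange of the sums
over j and k. The double series is dominated by a product of a convergent series in j and one in k.
-/
theorem flatSeries_freeJet {K : ℝ} {c : ℕ → ℝ} (hc : ∀ k, |c k| ≤ K) (p : ℕ) {t : ℝ} (ht : 0 < t)
    (x : ℝ) : flatSeries (freeJet c) p 0 t x =
      ∑' k : ℕ, c k * (-(k * Real.pi) ^ 2) ^ p * Real.exp (-(k * Real.pi) ^ 2 * t) *
        Real.cos (k * Real.pi * x) := by
  set f : ℕ → ℕ → ℝ := fun j k => x ^ j / j.factorial * (if Even j then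
    c k * (-(k * Real.pi) ^ 2) ^ (j / 2 + p) * Real.exp (-(k * Real.pi) ^ 2 * t) else 0)
  have hK : 0 ≤ K := (abs_nonneg _).trans (hc 0)
  have hsum : Summable (Function.uncurry f) := by
    set A := max (2 / t) 1
    -- An auxiliary sequence, constant in time, made of the constants of `abs_freeJet_term_le`: the
    -- bounds for flat series with s = 1 then give the summability in j.
    set z : ℕ → ℝ → ℝ := fun n _ => n.factorial * (2 / t) ^ n
    have hz : IsGevreyJet 1 1 A z Set.univ := by
      intro n r _
      simp only [z, Real.rpow_one, one_mul]
      rw [abs_of_nonneg (by positivity)]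
      gcongr
      exact le_max_left _ _
    have hA : 1 ≤ A := le_max_right _ _
    have h1 : Summable fun j : ℕ => |x| ^ j / j.factorial * evenCoeff z p (j + 0) 0 :=
      Summable.of_norm_bounded ((summable_flatWeight (X := |x| + 1) one_lt_two (by positivity)
        (by positivity)).mul_left _) fun j => norm_flatSeries_term_le zero_le_one one_lt_two
          zero_le_one hA hz p 0 j (Set.mem_univ _) (by rw [abs_abs]; linarith)
    have hz0 : ∀ j, 0 ≤ evenCoeff z p j 0 := fun j => by
      unfold evenCoeff
      split_ifs
      · positivity
      · exact le_rfl
    have h2 := (summable_exp_neg_sq (half_pos ht)).mul_left K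
    have h3 := h1.mul_of_nonneg h2 (fun j => mul_nonneg (by positivity) (hz0 _))
      (fun k => by positivity)
    refine Summable.of_norm_bounded h3 fun jk => ?_
    obtain ⟨j, k⟩ := jk
    simp only [Function.uncurry, f, evenCoeff, add_zero]
    rw [norm_mul, norm_div, norm_pow, Real.norm_natCast, Real.norm_eq_abs x]
    refine (mul_le_mul_of_nonneg_left (?_ : _ ≤ (if Even j then z (j / 2 + p) 0 else 0) *
      (K * Real.exp (-(k * Real.pi) ^ 2 * (t / 2)))) (by positivity)).trans_eq (by ring)
    split_ifs
    · exact (abs_freeJet_term_le hc ht _ k le_rfl).trans_eq (by simp only [z]; ring)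
    · simp
  have h1 : flatSeries (freeJet c) p 0 t x = ∑' j, ∑' k, f j k := by
    unfold flatSeries
    refine tsum_congr fun j => ?_
    rw [tsum_mul_left]
    congr 1
    unfold evenCoeff
    rw [add_zero]
    split_ifs
    · rfl
    · simp
  rw [h1, ← hsum.tsum_comm]
  refine tsum_congr fun k => ?_
  have h2 := (hasSum_cos_evenCoeff (k * Real.pi) x p).mul_left
    (c k * Real.exp (-(k * Real.pi) ^ 2 * t))
  refine (HasSum.tsum_eq (h2.congr_fun fun j => ?_)).trans (by ring)
  simp only [f]
  split_ifs <;> ring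

/-- Each mode cos(kπx) is even about x = 1. By `deriv_eq_zero_of_symm` the flux there vanishes,
without differentiating the cosine series. -/
theorem flatSeries_freeJet_one_add {K : ℝ} {c : ℕ → ℝ} (hc : ∀ k, |c k| ≤ K) (p : ℕ) {t : ℝ}
    (ht : 0 < t) (h : ℝ) :
    flatSeries (freeJet c) p 0 t (1 + h) = flatSeries (freeJet c) p 0 t (1 - h) := by
  rw [flatSeries_freeJet hc p ht, flatSeries_freeJet hc p ht]
  refine tsum_congr fun k => ?_
  congr 1
  rw [mul_add, mul_sub, mul_one, Real.cos_add, Real.cos_sub, Real.sin_nat_mul_pi]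
  ring

theorem deriv_eq_zero_of_symm {f : ℝ → ℝ} {a f' : ℝ} (hf : HasDerivAt f f' a)
    (h : ∀ r, f (a + r) = f (a - r)) : f' = 0 := by
  have h1 : HasDerivAt (fun r => f (a + r)) f' 0 :=
    HasDerivAt.comp_const_add a 0 (by simpa using hf)
  have h2 : HasDerivAt (fun r => f (a - r)) (-f') 0 :=
    HasDerivAt.comp_const_sub a 0 (by simpa using hf)
  simp only [h] at h1
  have := h1.unique h2
  linarith

/-! ### The cosine basis of L²(0,1) -/

/-- The functions `1, √2 cos (πx), √2 cos (2πx), …`. -/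
noncomputable def cosFun (n : ℕ) (x : ℝ) : ℝ :=
  (if n = 0 then 1 else √2) * Real.cos (n * Real.pi * x)

theorem continuous_cosFun (n : ℕ) : Continuous (cosFun n) := by
  unfold cosFun; fun_prop

theorem abs_cosFun_coeff_le (n : ℕ) : |(if n = 0 then 1 else √2 : ℝ)| ≤ √2 := by
  split_ifs
  · simp
  · rw [abs_of_nonneg (by positivity)]

theorem abs_cosFun_le (n : ℕ) (x : ℝ) : |cosFun n x| ≤ √2 := by
  unfold cosFun
  rw [abs_mul]
  calc _ ≤ √2 * 1 := mul_le_mul (abs_cosFun_coeff_le n) (Real.abs_cos_le_one _) (abs_nonneg _)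
        (by positivity)
    _ = _ := mul_one _

theorem setIntegral_Ioo_eq (f : ℝ → ℝ) :
    ∫ x in Set.Ioo (0 : ℝ) 1, f x = ∫ x in (0 : ℝ)..1, f x := by
  rw [intervalIntegral.integral_of_le zero_le_one, MeasureTheory.integral_Ioc_eq_integral_Ioo]

theorem integral_cos_int_mul_pi (j : ℤ) (hj : j ≠ 0) :
    ∫ x in (0 : ℝ)..1, Real.cos (j * Real.pi * x) = 0 := by
  have hj' : (j : ℝ) * Real.pi ≠ 0 := mul_ne_zero (by exact_mod_cast hj) Real.pi_ne_zero
  rw [intervalIntegral.integral_comp_mul_left (fun x => Real.cos x) hj']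
  simp [Real.sin_int_mul_pi]

theorem integral_cosFun_mul_cosFun (m n : ℕ) :
    ∫ x in Set.Ioo (0 : ℝ) 1, cosFun m x * cosFun n x = if m = n then 1 else 0 := by
  rw [setIntegral_Ioo_eq]
  have h : ∀ x : ℝ, cosFun m x * cosFun n x =
      ((if m = 0 then 1 else √2) * (if n = 0 then 1 else √2) / 2) *
      (Real.cos (((m - n : ℤ) : ℝ) * Real.pi * x) +
        Real.cos (((m + n : ℤ) : ℝ) * Real.pi * x)) := by
    intro x
    unfold cosFun
    push_cast
    rw [show ((m : ℝ) - n) * Real.pi * x = m * Real.pi * x - n * Real.pi * x by ring,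
      show ((m : ℝ) + n) * Real.pi * x = m * Real.pi * x + n * Real.pi * x by ring,
      Real.cos_sub, Real.cos_add]
    ring
  simp only [h]
  rw [intervalIntegral.integral_const_mul, intervalIntegral.integral_add
    (Continuous.intervalIntegrable (by fun_prop) _ _)
    (Continuous.intervalIntegrable (by fun_prop) _ _)]
  by_cases hmn : m = n
  · subst hmn
    rcases Nat.eq_zero_or_pos m with rfl | hm
    · simp; norm_num
    · rw [integral_cos_int_mul_pi ((m : ℤ) + m) (by omega)]
      simp [hm.ne']
  · rw [integral_cos_int_mul_pi ((m : ℤ) - n) (by omega),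
      integral_cos_int_mul_pi ((m : ℤ) + n) (by omega)]
    simp [hmn]

open MeasureTheory in
theorem integrable_mul_continuousOn {f g : ℝ → ℝ}
    (hf : Integrable f (volume.restrict (Set.Ioo 0 1)))
    (hg : ContinuousOn g (Set.Icc 0 1)) :
    Integrable (fun x => f x * g x) (volume.restrict (Set.Ioo (0 : ℝ) 1)) :=
  IntegrableOn.mul_continuousOn_of_subset hf hg measurableSet_Ioo isCompact_Icc
    Set.Ioo_subset_Icc_self

open MeasureTheory in
theorem integral_mul_polynomial_cos_eq_zero {f : ℝ → ℝ}
    (hf : Integrable f (volume.restrict (Set.Ioo 0 1)))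
    (h : ∀ n : ℕ, ∫ x in Set.Ioo (0 : ℝ) 1, f x * Real.cos (n * Real.pi * x) = 0)
    (P : Polynomial ℝ) : ∫ x in Set.Ioo (0 : ℝ) 1, f x * P.eval (Real.cos (Real.pi * x)) = 0 := by
  have hint : ∀ {g : ℝ → ℝ}, Continuous g →
      Integrable (fun x => f x * g x) (volume.restrict (Set.Ioo (0 : ℝ) 1)) := fun hg =>
    integrable_mul_continuousOn hf hg.continuousOn
  have hZ : ∀ j : ℤ, ∫ x in Set.Ioo (0 : ℝ) 1, f x * Real.cos (j * Real.pi * x) = 0 := by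
    intro j
    obtain ⟨n, rfl | rfl⟩ := j.eq_nat_or_neg
    · simpa using h n
    · simpa [neg_mul, Real.cos_neg] using h n
  -- The product-to-sum formula trades one factor cos(πx) for the frequencies j + 1 and j - 1;
  -- integer j keeps the induction closed.
  have hpow : ∀ (n : ℕ) (j : ℤ), ∫ x in Set.Ioo (0 : ℝ) 1,
      f x * (Real.cos (Real.pi * x) ^ n * Real.cos (j * Real.pi * x)) = 0 := by
    intro n
    induction n with
    | zero => simpa using hZ
    | succ n ih =>
      intro j
      have he : ∀ x, f x * (Real.cos (Real.pi * x) ^ (n + 1) * Real.cos (j * Real.pi * x)) =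
          1 / 2 * (f x * (Real.cos (Real.pi * x) ^ n * Real.cos ((j + 1 : ℤ) * Real.pi * x)) +
          f x * (Real.cos (Real.pi * x) ^ n * Real.cos ((j - 1 : ℤ) * Real.pi * x))) := by
        intro x
        push_cast
        rw [show ((j : ℝ) + 1) * Real.pi * x = j * Real.pi * x + Real.pi * x by ring,
          show ((j : ℝ) - 1) * Real.pi * x = j * Real.pi * x - Real.pi * x by ring,
          Real.cos_add, Real.cos_sub]
        ring
      simp only [he]
      rw [integral_const_mul, integral_add (hint (by fun_prop)) (hint (by fun_prop)), ih, ih]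
      simp
  induction P using Polynomial.induction_on' with
  | add p q hp hq =>
    simp only [Polynomial.eval_add, mul_add]
    rw [integral_add (hint (by fun_prop)) (hint (by fun_prop)), hp, hq, add_zero]
  | monomial n a =>
    have h1 := hpow n 0
    simp only [Polynomial.eval_monomial, mul_left_comm _ a]
    rw [integral_const_mul]
    simp only [Int.cast_zero, zero_mul, Real.cos_zero, mul_one] at h1
    rw [h1, mul_zero]

open MeasureTheory in
/-- The functions `cos (nπx)` are total in `L¹(0,1)`. -/
theorem ae_eq_zero_of_integral_mul_cos_eq_zero {f : ℝ → ℝ}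
    (hf : Integrable f (volume.restrict (Set.Ioo 0 1)))
    (h : ∀ n : ℕ, ∫ x in Set.Ioo (0 : ℝ) 1, f x * Real.cos (n * Real.pi * x) = 0) :
    f =ᵐ[volume.restrict (Set.Ioo (0 : ℝ) 1)] 0 := by
  refine ae_eq_zero_of_integral_contDiff_smul_eq_zero hf.locallyIntegrable fun g hg _ => ?_
  have hgc : Continuous g := hg.continuous
  set N := ∫ x in Set.Ioo (0 : ℝ) 1, |f x|
  have key : ∀ ε : ℝ, 0 < ε → |∫ x in Set.Ioo (0 : ℝ) 1, g x • f x| ≤ ε * N := by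
    intro ε hε
    -- On [0,1], g is a continuous function of z = cos(πx) through arccos, and Weierstrass
    -- approximation applies in z.
    obtain ⟨P, hP⟩ := exists_polynomial_near_of_continuousOn (-1) 1
      (fun z => g (Real.arccos z / Real.pi)) (by fun_prop) ε hε
    have h1 := integral_mul_polynomial_cos_eq_zero hf h P
    have h2 : ∫ x in Set.Ioo (0 : ℝ) 1, g x • f x = ∫ x in Set.Ioo (0 : ℝ) 1,
        f x * (g x - P.eval (Real.cos (Real.pi * x))) := by
      simp only [mul_sub]
      rw [integral_sub (integrable_mul_continuousOn hf hgc.continuousOn)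
        (integrable_mul_continuousOn hf (by fun_prop)), h1, sub_zero]
      simp only [smul_eq_mul, mul_comm]
    rw [h2, ← Real.norm_eq_abs, ← integral_const_mul]
    refine norm_integral_le_of_norm_le (hf.norm.const_mul ε) ?_
    filter_upwards [ae_restrict_mem measurableSet_Ioo] with x hx
    have h3 := hP (Real.cos (Real.pi * x)) ⟨Real.neg_one_le_cos _, Real.cos_le_one _⟩
    rw [Real.arccos_cos (by have := hx.1; positivity) (by nlinarith [hx.2, Real.pi_pos]),
      mul_div_cancel_left₀ _ Real.pi_ne_zero, abs_sub_comm] at h3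
    rw [norm_mul, mul_comm, Real.norm_eq_abs, Real.norm_eq_abs]
    gcongr
  have hlim : Filter.Tendsto (fun ε : ℝ => ε * N) (nhdsWithin 0 (Set.Ioi 0)) (nhds 0) := by
    have : Filter.Tendsto (fun ε : ℝ => ε * N) (nhds 0) (nhds (0 * N)) :=
      Filter.tendsto_id.mul_const N
    rw [zero_mul] at this
    exact this.mono_left nhdsWithin_le_nhds
  exact abs_nonpos_iff.1 (ge_of_tendsto hlim (by
    filter_upwards [self_mem_nhdsWithin] with ε hε using key ε hε))

open MeasureTheory in
theorem integrable_coe_L2 (Φ : L2) : Integrable (Φ : ℝ → ℝ) (volume.restrict (Set.Ioo 0 1)) :=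
  (Lp.memLp Φ).integrable one_le_two

open MeasureTheory in
theorem L2_eq_of_integral_mul_cos_eq {Φ Ψ : L2}
    (h : ∀ n : ℕ, ∫ x in Set.Ioo (0 : ℝ) 1, Φ x * Real.cos (n * Real.pi * x) =
      ∫ x in Set.Ioo (0 : ℝ) 1, Ψ x * Real.cos (n * Real.pi * x)) : Φ = Ψ := by
  have h0 := ae_eq_zero_of_integral_mul_cos_eq_zero
    ((integrable_coe_L2 Φ).sub (integrable_coe_L2 Ψ)) fun n => by
      simp only [Pi.sub_apply, sub_mul]
      rw [integral_sub (integrable_mul_continuousOn (integrable_coe_L2 Φ) (by fun_prop))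
        (integrable_mul_continuousOn (integrable_coe_L2 Ψ) (by fun_prop)), h n, sub_self]
  refine Lp.ext ?_
  filter_upwards [h0] with x hx
  simpa [sub_eq_zero] using hx

open MeasureTheory in
theorem memLp_of_continuousOn {f : ℝ → ℝ} (hf : ContinuousOn f (Set.Icc 0 1)) :
    MemLp f 2 (volume.restrict (Set.Ioo (0 : ℝ) 1)) := by
  obtain ⟨C, hC⟩ := isCompact_Icc.exists_bound_of_continuousOn hf
  refine MemLp.of_bound ((hf.mono Set.Ioo_subset_Icc_self).aestronglyMeasurable
    measurableSet_Ioo) C ?_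
  filter_upwards [ae_restrict_mem measurableSet_Ioo] with x hx
  exact hC x (Set.Ioo_subset_Icc_self hx)

open MeasureTheory in
theorem inner_toLp_left {g : ℝ → ℝ} (hg : MemLp g 2 (volume.restrict (Set.Ioo (0 : ℝ) 1)))
    (Φ : L2) : inner ℝ (hg.toLp g) Φ = ∫ x in Set.Ioo (0 : ℝ) 1, Φ x * g x := by
  rw [L2.inner_def]
  refine integral_congr_ae ?_
  filter_upwards [hg.coeFn_toLp] with x hx
  rw [hx]; rfl

/-- The class in `L²(0,1)` of `cosFun n`. -/
noncomputable def cosLp (n : ℕ) : L2 :=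
  (memLp_of_continuousOn (continuous_cosFun n).continuousOn).toLp (cosFun n)

open MeasureTheory in
theorem inner_cosLp (n : ℕ) (Φ : L2) :
    inner ℝ (cosLp n) Φ = ∫ x in Set.Ioo (0 : ℝ) 1, Φ x * cosFun n x :=
  inner_toLp_left _ Φ

open MeasureTheory in
theorem orthonormal_cosLp : Orthonormal ℝ cosLp := by
  rw [orthonormal_iff_ite]
  intro m n
  rw [inner_cosLp, ← integral_cosFun_mul_cosFun m n]
  simp only [mul_comm (cosFun m _)]
  refine integral_congr_ae ?_
  filter_upwards [(memLp_of_continuousOn (continuous_cosFun n).continuousOn).coeFn_toLp] with x hx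
  rw [← hx]; rfl

theorem span_cosLp_orthogonal : (Submodule.span ℝ (Set.range cosLp)).orthogonal = ⊥ := by
  rw [Submodule.eq_bot_iff]
  intro Φ hΦ
  refine L2_eq_of_integral_mul_cos_eq fun n => ?_
  have h := Submodule.inner_right_of_mem_orthogonal
    (Submodule.subset_span (Set.mem_range_self n)) hΦ
  rw [inner_cosLp] at h
  have h2 : ∫ x in Set.Ioo (0 : ℝ) 1, (0 : L2) x * Real.cos (n * Real.pi * x) = 0 := by
    refine MeasureTheory.integral_eq_zero_of_ae ?_
    filter_upwards [MeasureTheory.Lp.coeFn_zero ℝ 2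
      (MeasureTheory.volume.restrict (Set.Ioo (0 : ℝ) 1))] with x hx
    rw [hx]; simp
  rw [h2]
  simp only [cosFun, mul_left_comm _ (if n = 0 then (1 : ℝ) else √2)] at h
  rw [MeasureTheory.integral_const_mul] at h
  refine (mul_eq_zero.1 h).resolve_left ?_
  split_ifs <;> simp

/-- The Hilbert basis of `L²(0,1)` made of cosines. -/
noncomputable def cosBasis : HilbertBasis ℕ ℝ L2 :=
  HilbertBasis.mkOfOrthogonalEqBot orthonormal_cosLp span_cosLp_orthogonal

theorem cosBasis_apply (n : ℕ) : cosBasis n = cosLp n :=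
  congrFun (HilbertBasis.coe_mkOfOrthogonalEqBot orthonormal_cosLp span_cosLp_orthogonal) n

theorem hasSum_inner_cosLp_sq (Φ : L2) :
    HasSum (fun n => (inner ℝ (cosLp n) Φ : ℝ) ^ 2) (‖Φ‖ ^ 2) := by
  have h := cosBasis.hasSum_inner_mul_inner Φ Φ
  rw [real_inner_self_eq_norm_sq] at h
  refine h.congr_fun fun n => ?_
  rw [cosBasis_apply, real_inner_comm, pow_two]

theorem abs_inner_cosLp_le (n : ℕ) (Φ : L2) : |(inner ℝ (cosLp n) Φ : ℝ)| ≤ ‖Φ‖ := by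
  have h := abs_real_inner_le_norm (cosLp n) Φ
  rwa [orthonormal_cosLp.norm_eq_one, one_mul] at h

/-- Convergence to the initial state in `L²(0,1)` of the free evolution. -/
theorem tendsto_of_inner_cosLp {Θ : ℝ → L2} {θ₀ : L2}
    (h : ∀ᶠ t in nhdsWithin 0 (Set.Ioi 0), ∀ n : ℕ, (inner ℝ (cosLp n) (Θ t) : ℝ) =
      Real.exp (-(n * Real.pi) ^ 2 * t) * inner ℝ (cosLp n) θ₀) :
    Filter.Tendsto Θ (nhdsWithin 0 (Set.Ioi 0)) (nhds θ₀) := by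
  rw [tendsto_iff_norm_sub_tendsto_zero]
  -- By Parseval this sum is the squared distance to θ₀. Dominated convergence applies, the squared
  -- coefficients of θ₀ being a summable majorant.
  have hsq : Filter.Tendsto (fun t : ℝ => ∑' n : ℕ, ((Real.exp (-(n * Real.pi) ^ 2 * t) - 1) *
      inner ℝ (cosLp n) θ₀ : ℝ) ^ 2) (nhdsWithin 0 (Set.Ioi 0)) (nhds 0) := by
    have hlim := tendsto_tsum_of_dominated_convergence (𝓕 := nhdsWithin (0 : ℝ) (Set.Ioi 0))
      (f := fun t (n : ℕ) => ((Real.exp (-(n * Real.pi) ^ 2 * t) - 1) *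
        inner ℝ (cosLp n) θ₀ : ℝ) ^ 2) (g := fun _ : ℕ => (0 : ℝ))
      (hasSum_inner_cosLp_sq θ₀).summable (fun n => ?_) ?_
    · rwa [tsum_zero] at hlim
    · have : Continuous fun t : ℝ => ((Real.exp (-(n * Real.pi) ^ 2 * t) - 1) *
        inner ℝ (cosLp n) θ₀ : ℝ) ^ 2 := by fun_prop
      have h0 := this.tendsto 0
      simp only [mul_zero, Real.exp_zero, sub_self, zero_mul] at h0
      rw [zero_pow two_ne_zero] at h0
      exact h0.mono_left nhdsWithin_le_nhds
    · filter_upwards [self_mem_nhdsWithin] with t ht n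
      have ht : 0 < t := ht
      rw [Real.norm_of_nonneg (sq_nonneg _), mul_pow]
      have h1 : Real.exp (-(n * Real.pi) ^ 2 * t) ≤ 1 := by
        rw [Real.exp_le_one_iff]
        nlinarith [sq_nonneg ((n : ℝ) * Real.pi)]
      have h2 := Real.exp_pos (-(n * Real.pi) ^ 2 * t)
      calc _ ≤ 1 * (inner ℝ (cosLp n) θ₀ : ℝ) ^ 2 := by
            gcongr
            nlinarith
        _ = _ := one_mul _
  have hsqrt := hsq.sqrt
  rw [Real.sqrt_zero] at hsqrt
  refine hsqrt.congr' ?_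
  filter_upwards [h] with t ht
  rw [Real.sqrt_eq_iff_mul_self_eq (tsum_nonneg fun _ => sq_nonneg _) (norm_nonneg _), ← pow_two,
    ← (hasSum_inner_cosLp_sq (Θ t - θ₀)).tsum_eq]
  refine tsum_congr fun n => ?_
  rw [inner_sub_right, ht n]
  ring

/-! ### Uniqueness of weak solutions -/

/-- Integrating factor for D' = cD, D(0) = 0. Continuity of D is not assumed; it follows from the
integral identity. -/
theorem eq_zero_of_eq_integral {D : ℝ → ℝ} {c T : ℝ} (hT : 0 ≤ T)
    (hint : IntervalIntegrable (fun r => c * D r) MeasureTheory.volume 0 T)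
    (h : ∀ t ∈ Set.Icc 0 T, D t = ∫ r in (0 : ℝ)..t, c * D r) : ∀ t ∈ Set.Icc 0 T, D t = 0 := by
  have hD : ContinuousOn D (Set.Icc 0 T) := by
    have h1 := intervalIntegral.continuousOn_primitive_interval' hint Set.left_mem_uIcc
    rw [Set.uIcc_of_le hT] at h1
    exact h1.congr h
  -- Extending D by constants outside [0,T] makes its primitive differentiable at the end points
  -- too.
  set E := Set.IccExtend hT (Set.domRestrict (Set.Icc 0 T) D)
  have hE : Continuous E := (continuousOn_iff_continuous_domRestrict.1 hD).Icc_extend'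
  have hED : ∀ t ∈ Set.Icc 0 T, E t = D t := fun t ht => by
    simp only [E]; rw [Set.IccExtend_of_mem _ _ ht]; rfl
  set F := fun t => ∫ r in (0 : ℝ)..t, c * E r
  have hF : ∀ t, HasDerivAt F (c * E t) t := fun t =>
    ((hE.const_mul c).integral_hasStrictDerivAt 0 t).hasDerivAt
  have hFD : ∀ t ∈ Set.Icc 0 T, F t = D t := by
    intro t ht
    rw [h t ht]
    refine intervalIntegral.integral_congr fun r hr => ?_
    rw [Set.uIcc_of_le ht.1] at hr
    rw [hED r ⟨hr.1, hr.2.trans ht.2⟩]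
  have hG : ∀ t ∈ Set.Icc 0 T, HasDerivAt (fun t => Real.exp (-c * t) * F t) 0 t := by
    intro t ht
    have h1 := (((hasDerivAt_id t).const_mul (-c)).exp).mul (hF t)
    refine h1.congr_deriv ?_
    rw [hED t ht, hFD t ht]
    simp only [id]
    ring
  have hconst := constant_of_has_deriv_right_zero
    (fun t ht => (hG t ht).continuousAt.continuousWithinAt)
    (fun t ht => (hG t ⟨ht.1, ht.2.le⟩).hasDerivWithinAt)
  intro t ht
  have h1 := hconst t ht
  have h0 : F 0 = 0 := intervalIntegral.integral_same
  rw [h0, mul_zero, hFD t ht] at h1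
  exact (mul_eq_zero.1 h1).resolve_left (Real.exp_pos _).ne'

theorem hasDerivAt_cos_mul (l x : ℝ) :
    HasDerivAt (fun x => Real.cos (l * x)) (-(l * Real.sin (l * x))) x := by
  refine ((hasDerivAt_id x).const_mul l).cos.congr_deriv ?_
  simp only [id]; ring

theorem deriv_deriv_cos_mul (l : ℝ) :
    deriv (deriv fun x => Real.cos (l * x)) = fun x => -l ^ 2 * Real.cos (l * x) := by
  have h1 : deriv (fun x => Real.cos (l * x)) = fun x => -(l * Real.sin (l * x)) :=
    funext fun x => (hasDerivAt_cos_mul l x).deriv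
  rw [h1]
  funext x
  have h2 := ((((hasDerivAt_id x).const_mul l).sin).const_mul l).neg
  refine (h2.congr_deriv ?_).deriv
  simp only [id]; ring

/-- Weak solutions are unique. -/
theorem IsWeakSolution.unique {T : ℝ} (hT : 0 ≤ T) {u : ℝ → ℝ} {θ₀ : L2} {Θ Θ' : ℝ → L2}
    (h : IsWeakSolution T u θ₀ Θ) (h' : IsWeakSolution T u θ₀ Θ') {t : ℝ}
    (ht : t ∈ Set.Icc 0 T) : Θ' t = Θ t := by
  refine L2_eq_of_integral_mul_cos_eq fun n => ?_
  -- The test function cos(nπx) is a Neumann eigenfunction, so the equation for its pairing with the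
  -- difference closes up, and the control terms cancel.
  set l := (n : ℝ) * Real.pi
  set φ : ℝ → ℝ := fun x => Real.cos (l * x)
  have hφ : ContDiff ℝ 2 φ := by fun_prop
  have h0 : deriv φ 0 = 0 := by rw [(hasDerivAt_cos_mul l 0).deriv]; simp
  have h1 : deriv φ 1 = 0 := by
    rw [(hasDerivAt_cos_mul l 1).deriv, mul_one, Real.sin_nat_mul_pi]; simp
  have hφ2 : ∀ Φ : L2, ∫ x in Set.Ioo (0 : ℝ) 1, Φ x * deriv (deriv φ) x =
      -l ^ 2 * ∫ x in Set.Ioo (0 : ℝ) 1, Φ x * φ x := by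
    intro Φ
    rw [← MeasureTheory.integral_const_mul, deriv_deriv_cos_mul]
    exact MeasureTheory.integral_congr_ae (Filter.Eventually.of_forall fun x => by
      simp only [φ]; ring)
  set D : ℝ → ℝ := fun r => (∫ x in Set.Ioo (0 : ℝ) 1, Θ' r x * φ x) -
    ∫ x in Set.Ioo (0 : ℝ) 1, Θ r x * φ x
  have hi := h.integrable φ hφ h0 h1
  have hi' := h'.integrable φ hφ h0 h1
  have hsub : ∀ r, ((∫ x in Set.Ioo (0 : ℝ) 1, Θ' r x * deriv (deriv φ) x) + u r * φ 1) -
      ((∫ x in Set.Ioo (0 : ℝ) 1, Θ r x * deriv (deriv φ) x) + u r * φ 1) = -l ^ 2 * D r := by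
    intro r
    rw [hφ2, hφ2]
    simp only [D]; ring
  refine sub_eq_zero.1 (eq_zero_of_eq_integral (D := D) (c := -l ^ 2) hT ?_ (fun r hr => ?_) t ht)
  · refine (hi'.sub hi).congr fun r _ => ?_
    exact hsub r
  · simp only [← hsub]
    have hsubset : Set.uIcc 0 r ⊆ Set.uIcc 0 T := by
      rw [Set.uIcc_of_le hr.1, Set.uIcc_of_le hT]
      exact Set.Icc_subset_Icc_right hr.2
    rw [intervalIntegral.integral_sub (hi'.mono_set hsubset) (hi.mono_set hsubset)]
    simp only [D]
    rw [h.weak φ hφ h0 h1 r hr, h'.weak φ hφ h0 h1 r hr]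
    ring

/-! ### Boundary values and weak formulation for flat series -/

theorem IsGevreyJet.mono {s s' M M' A A' : ℝ} {a : ℕ → ℝ → ℝ} {S : Set ℝ}
    (h : IsGevreyJet s M A a S)
    (hs : s ≤ s') (hM0 : 0 ≤ M) (hM : M ≤ M') (hA0 : 0 ≤ A) (hA : A ≤ A') :
    IsGevreyJet s' M' A' a S := by
  intro n t ht
  refine (h n t ht).trans ?_
  have : (1 : ℝ) ≤ n.factorial := by exact_mod_cast Nat.one_le_iff_ne_zero.2 n.factorial_ne_zero
  have hM' := hM0.trans hM
  gcongr

theorem leibniz_eq_of_one (a b : ℕ → ℝ → ℝ) {t : ℝ} (h0 : b 0 t = 1) (h : ∀ n, b (n + 1) t = 0)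
    (n : ℕ) : leibniz a b n t = a n t := by
  unfold leibniz
  rw [Finset.sum_eq_single (n, 0)]
  · simp [h0]
  · rintro ⟨i, j⟩ hij hne
    rw [Finset.HasAntidiagonal.mem_antidiagonal] at hij
    cases j with
    | zero => exact absurd (by rw [← hij]; rfl) hne
    | succ j => simp [h]
  · simp

theorem leibniz_eq_zero (a b : ℕ → ℝ → ℝ) {t : ℝ} (h : ∀ n, b n t = 0) (n : ℕ) :
    leibniz a b n t = 0 :=
  Finset.sum_eq_zero fun ij _ => by rw [h]; ring

theorem flatSeries_congr {y z : ℕ → ℝ → ℝ} {t : ℝ} (h : ∀ n, y n t = z n t) (p q : ℕ) (x : ℝ) :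
    flatSeries y p q t x = flatSeries z p q t x := by
  unfold flatSeries evenCoeff
  simp only [h]

theorem flatSeries_eq_zero {y : ℕ → ℝ → ℝ} {t : ℝ} (h : ∀ n, y n t = 0) (p q : ℕ) (x : ℝ) :
    flatSeries y p q t x = 0 := by
  unfold flatSeries evenCoeff
  simp [h]

theorem flatSeries_one_zero (y : ℕ → ℝ → ℝ) (p : ℕ) (t : ℝ) : flatSeries y p 1 t 0 = 0 := by
  unfold flatSeries
  rw [tsum_eq_single 0]
  · simp [evenCoeff]
  · intro j hj
    simp [hj]

namespace IsFlatOutput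

variable {s M A a : ℝ} {y : ℕ → ℝ → ℝ}

theorem hasSum_boundary (h : IsFlatOutput s M A a y) {t : ℝ} (ht : a < t) :
    HasSum (fun i : ℕ => y (i + 1) t / ((2 * i + 1).factorial : ℝ)) (flatSeries y 0 1 t 1) := by
  have hinj : Function.Injective fun i : ℕ => 2 * i + 1 := fun i j h => by
    simp only at h; omega
  have h1 := (h.summable_term 0 1 ht 1).hasSum
  rw [← hinj.hasSum_iff] at h1
  · refine h1.congr_fun fun i => ?_
    have h2 : Even (2 * i + 1 + 1) := ⟨i + 1, by ring⟩
    have h3 : (2 * i + 1 + 1) / 2 + 0 = i + 1 := by omega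
    simp only [Function.comp, evenCoeff, if_pos h2, h3, one_pow]
    ring
  · intro j hj
    have : ¬ Even (j + 1) := fun ⟨i, hi⟩ => hj ⟨i - 1, by simp only; omega⟩
    simp [evenCoeff, this]

theorem continuous_space (h : IsFlatOutput s M A a y) (p q : ℕ) {t : ℝ} (ht : a < t) :
    Continuous (flatSeries y p q t) :=
  continuous_iff_continuousAt.2 fun x => (h.hasDerivAt_space p q ht x).continuousAt

open MeasureTheory in
theorem hasDerivAt_integral_mul (h : IsFlatOutput s M A a y) {t : ℝ} (ht : a < t) {φ : ℝ → ℝ}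
    (hφ : ContDiff ℝ 2 φ) (h0 : deriv φ 0 = 0) (h1 : deriv φ 1 = 0) :
    HasDerivAt (fun t => ∫ x in Set.Ioo (0 : ℝ) 1, flatSeries y 0 0 t x * φ x)
      ((∫ x in Set.Ioo (0 : ℝ) 1, flatSeries y 0 0 t x * deriv (deriv φ) x) +
        flatSeries y 0 1 t 1 * φ 1) t := by
  have hφc : Continuous φ := hφ.continuous
  have hint : ∀ {f : ℝ → ℝ}, Continuous f → Integrable f (volume.restrict (Set.Ioo (0 : ℝ) 1)) :=
    fun hf => (hf.continuousOn.integrableOn_Icc (a := 0) (b := 1)).mono_set Set.Ioo_subset_Icc_self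
  set B := M * (((1 : ℕ).factorial : ℝ) ^ s * ((0 : ℕ).factorial : ℝ) ^ (s / 2)) *
      ((2 ^ s * A) ^ 1 * (2 * (2 ^ s * A)) ^ 0) * ∑' j, flatWeight s (2 ^ s * A) 1 j
  have key := (hasDerivAt_integral_of_dominated_loc_of_deriv_le
    (μ := volume.restrict (Set.Ioo (0 : ℝ) 1))
    (F := fun t x => flatSeries y 0 0 t x * φ x) (F' := fun t x => flatSeries y 1 0 t x * φ x)
    (bound := fun x => B * |φ x|) (x₀ := t) (s := Set.Ioi a) (Ioi_mem_nhds ht)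
    (by
      filter_upwards [Ioi_mem_nhds ht] with r hr
      exact ((h.continuous_space 0 0 hr).mul hφc).aestronglyMeasurable)
    (hint ((h.continuous_space 0 0 ht).mul hφc))
    ((h.continuous_space 1 0 ht).mul hφc).aestronglyMeasurable
    (by
      filter_upwards [ae_restrict_mem measurableSet_Ioo] with x hx r hr
      rw [norm_mul, Real.norm_eq_abs, Real.norm_eq_abs]
      gcongr
      exact h.abs_flatSeries_le one_pos 1 0 hr (abs_le.2 ⟨by linarith [hx.1], hx.2.le⟩))
    (hint (by fun_prop))
    (Filter.Eventually.of_forall fun x r hr =>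
      (h.hasDerivAt_time 0 0 hr x).mul_const (φ x))).2
  refine key.congr_deriv ?_
  have hd : ∀ x, HasDerivAt φ (deriv φ x) x := fun x =>
    (hφ.differentiable (by norm_num)).differentiableAt.hasDerivAt
  have hφ' : ContDiff ℝ 1 (deriv φ) := by
    have : ContDiff ℝ (1 + 1) φ := by norm_num; exact hφ
    exact (contDiff_succ_iff_deriv.1 this).2.2
  have hdd : ∀ x, HasDerivAt (deriv φ) (deriv (deriv φ) x) x := fun x =>
    (hφ'.differentiable (by norm_num)).differentiableAt.hasDerivAt
  have hφ'' : Continuous (deriv (deriv φ)) := hφ'.continuous_deriv le_rfl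
  rw [setIntegral_Ioo_eq, setIntegral_Ioo_eq]
  have e1 := intervalIntegral.integral_mul_deriv_eq_deriv_mul (a := 0) (b := 1)
    (fun x _ => hd x) (fun x _ => h.hasDerivAt_space 0 1 ht x)
    (hφ'.continuous.intervalIntegrable _ _) ((h.continuous_space 0 2 ht).intervalIntegrable _ _)
  have e2 := intervalIntegral.integral_mul_deriv_eq_deriv_mul (a := 0) (b := 1)
    (fun x _ => hdd x) (fun x _ => h.hasDerivAt_space 0 0 ht x)
    (hφ''.intervalIntegrable _ _) ((h.continuous_space 0 1 ht).intervalIntegrable _ _)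
  rw [h0, h1] at e2
  rw [e2, flatSeries_one_zero, flatSeries_add_two] at e1
  simp only [mul_comm _ (φ _), mul_comm _ (deriv (deriv φ) _)]
  rw [e1]
  ring

theorem abs_sub_le (h : IsFlatOutput s M A a y) : ∃ C : ℝ, 0 ≤ C ∧ ∀ t r x : ℝ, a < t → a < r →
    |x| ≤ 1 → |flatSeries y 0 0 r x - flatSeries y 0 0 t x| ≤ C * |r - t| := by
  refine ⟨|M * (((1 : ℕ).factorial : ℝ) ^ s * ((0 : ℕ).factorial : ℝ) ^ (s / 2)) *
      ((2 ^ s * A) ^ 1 * (2 * (2 ^ s * A)) ^ 0) * ∑' j, flatWeight s (2 ^ s * A) 1 j|,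
      abs_nonneg _, fun t r x ht hr hx => ?_⟩
  exact (convex_Ioi a).norm_image_sub_le_of_norm_hasDerivWithin_le
    (fun v hv => (h.hasDerivAt_time 0 0 hv x).hasDerivWithinAt)
    (fun v hv => (h.abs_flatSeries_le one_pos 1 0 hv hx).trans (le_abs_self _)) ht hr

end IsFlatOutput

/-- The trajectory in `L²(0,1)` starting at `θ₀` and given by a function for `t > 0`. -/
noncomputable def trajectory (θ₀ : L2) (g : ℝ → ℝ → ℝ)
    (hg : ∀ t, 0 < t → Continuous (g t)) (t : ℝ) : L2 :=
  if h : 0 < t then (memLp_of_continuousOn (hg t h).continuousOn).toLp (g t) else θ₀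

section trajectory

variable {θ₀ : L2} {g : ℝ → ℝ → ℝ} {hg : ∀ t, 0 < t → Continuous (g t)}

theorem trajectory_zero : trajectory θ₀ g hg 0 = θ₀ := dif_neg (lt_irrefl _)

theorem coe_trajectory {t : ℝ} (ht : 0 < t) : (trajectory θ₀ g hg t : ℝ → ℝ)
    =ᵐ[MeasureTheory.volume.restrict (Set.Ioo (0 : ℝ) 1)] g t := by
  unfold trajectory
  rw [dif_pos ht]
  exact MeasureTheory.MemLp.coeFn_toLp _

theorem integral_trajectory_mul {t : ℝ} (ht : 0 < t) (φ : ℝ → ℝ) :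
    ∫ x in Set.Ioo (0 : ℝ) 1, trajectory θ₀ g hg t x * φ x =
      ∫ x in Set.Ioo (0 : ℝ) 1, g t x * φ x := by
  refine MeasureTheory.integral_congr_ae ?_
  filter_upwards [coe_trajectory (θ₀ := θ₀) (hg := hg) ht] with x hx
  rw [hx]

open MeasureTheory in
theorem norm_trajectory_sub_le {t r C : ℝ} (ht : 0 < t) (hr : 0 < r) (hC : 0 ≤ C)
    (h : ∀ x ∈ Set.Ioo (0 : ℝ) 1, |g r x - g t x| ≤ C) :
    ‖trajectory θ₀ g hg r - trajectory θ₀ g hg t‖ ≤ C := by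
  refine (Lp.norm_le_of_ae_bound hC ?_).trans_eq ?_
  · filter_upwards [coe_trajectory (θ₀ := θ₀) (hg := hg) ht,
      coe_trajectory (θ₀ := θ₀) (hg := hg) hr, ae_restrict_mem measurableSet_Ioo,
      Lp.coeFn_sub (trajectory θ₀ g hg r) (trajectory θ₀ g hg t)] with x h1 h2 hx h3
    rw [h3, Pi.sub_apply, h1, h2]
    exact h x hx
  · simp [measureUnivNNReal]

end trajectory

/-- The coefficients of `θ₀` on the functions `cos (kπx)`. -/
noncomputable def cosCoeff (θ₀ : L2) (k : ℕ) : ℝ :=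
  (if k = 0 then 1 else √2) * inner ℝ (cosLp k) θ₀

theorem abs_cosCoeff_le (θ₀ : L2) (k : ℕ) : |cosCoeff θ₀ k| ≤ √2 * ‖θ₀‖ := by
  unfold cosCoeff
  rw [abs_mul]
  exact mul_le_mul (abs_cosFun_coeff_le k) (abs_inner_cosLp_le k θ₀) (abs_nonneg _) (by positivity)

theorem flatSeries_freeJet_cosCoeff (θ₀ : L2) {t : ℝ} (ht : 0 < t) (x : ℝ) :
    flatSeries (freeJet (cosCoeff θ₀)) 0 0 t x = ∑' k : ℕ,
      Real.exp (-(k * Real.pi) ^ 2 * t) * inner ℝ (cosLp k) θ₀ * cosFun k x := by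
  rw [flatSeries_freeJet (abs_cosCoeff_le θ₀) 0 ht]
  refine tsum_congr fun k => ?_
  unfold cosCoeff cosFun
  ring

open MeasureTheory in
/-- The cosine coefficients of the free evolution. -/
theorem integral_flatSeries_freeJet_mul_cosFun (θ₀ : L2) {t : ℝ} (ht : 0 < t) (n : ℕ) :
    ∫ x in Set.Ioo (0 : ℝ) 1, flatSeries (freeJet (cosCoeff θ₀)) 0 0 t x * cosFun n x =
      Real.exp (-(n * Real.pi) ^ 2 * t) * inner ℝ (cosLp n) θ₀ := by
  set d : ℕ → ℝ := fun k => Real.exp (-(k * Real.pi) ^ 2 * t) * inner ℝ (cosLp k) θ₀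
  have hd : ∀ k, |d k| ≤ ‖θ₀‖ * Real.exp (-(k * Real.pi) ^ 2 * t) := fun k => by
    simp only [d]
    rw [abs_mul, abs_of_pos (Real.exp_pos _), mul_comm]
    gcongr
    exact abs_inner_cosLp_le k θ₀
  have hint : ∀ k, Integrable (fun x => d k * (cosFun k x * cosFun n x))
      (volume.restrict (Set.Ioo (0 : ℝ) 1)) := fun k =>
    ((((continuous_cosFun k).mul (continuous_cosFun n)).const_mul
      (d k)).continuousOn.integrableOn_Icc (a := 0) (b := 1)).mono_set Set.Ioo_subset_Icc_self
  have hbound : ∀ k x, ‖d k * (cosFun k x * cosFun n x)‖ ≤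
      ‖θ₀‖ * Real.exp (-(k * Real.pi) ^ 2 * t) * (√2 * √2) := fun k x => by
    rw [norm_mul (d k), norm_mul (cosFun k x)]
    exact mul_le_mul (hd k) (mul_le_mul (abs_cosFun_le k x) (abs_cosFun_le n x) (abs_nonneg _)
      (by positivity)) (by positivity) (by positivity)
  have hsum : Summable fun k => ∫ x in Set.Ioo (0 : ℝ) 1, ‖d k * (cosFun k x * cosFun n x)‖ := by
    refine Summable.of_nonneg_of_le (fun k => integral_nonneg fun x => norm_nonneg _) (fun k => ?_)
      (((summable_exp_neg_sq ht).mul_left ‖θ₀‖).mul_right (√2 * √2))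
    have h1 := integral_mono (hint k).norm (integrable_const _) (hbound k)
    simpa using h1
  have h2 := integral_tsum_of_summable_integral_norm hint hsum
  have h3 : ∀ x, flatSeries (freeJet (cosCoeff θ₀)) 0 0 t x * cosFun n x =
      ∑' k, d k * (cosFun k x * cosFun n x) := fun x => by
    rw [flatSeries_freeJet_cosCoeff θ₀ ht, ← tsum_mul_right]
    exact tsum_congr fun k => by simp only [d]; ring
  simp only [h3]
  rw [← h2, tsum_eq_single n]
  · rw [integral_const_mul, integral_cosFun_mul_cosFun, if_pos rfl, mul_one]
  · intro k hk
    rw [integral_const_mul, integral_cosFun_mul_cosFun, if_neg hk, mul_zero]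

theorem exists_isFlatOutput_freeJet {K : ℝ} {c : ℕ → ℝ} (hc : ∀ k, |c k| ≤ K) {δ : ℝ}
    (hδ : 0 < δ) : ∃ M A : ℝ, IsFlatOutput 1 M A δ (freeJet c) := by
  obtain ⟨M, hM, h⟩ := exists_isGevreyJet_freeJet hc hδ
  exact ⟨M, max (2 / δ) 1, zero_le_one, one_lt_two, hM, le_max_right _ _,
    (isJet_freeJet hc).mono (Set.Ioi_subset_Ioi hδ.le),
    h.mono le_rfl hM le_rfl (by positivity) (le_max_left _ _)⟩

theorem flatSeries_freeJet_one_one {K : ℝ} {c : ℕ → ℝ} (hc : ∀ k, |c k| ≤ K) (p : ℕ) {t : ℝ}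
    (ht : 0 < t) : flatSeries (freeJet c) p 1 t 1 = 0 := by
  obtain ⟨M, A, h⟩ := exists_isFlatOutput_freeJet hc (half_pos ht)
  exact deriv_eq_zero_of_symm (h.hasDerivAt_space p 0 (half_lt_self ht) 1)
    (flatSeries_freeJet_one_add hc p ht)

/-- A flat output steering `θ₀` to `0`: it is the one of the free evolution up to time `τ` and
vanishes from time `T` on. -/
structure IsSteering (θ₀ : L2) (τ T s : ℝ) (y : ℕ → ℝ → ℝ) : Prop where
  flat : ∀ a, 0 < a → ∃ M A, IsFlatOutput s M A a y
  free : ∀ n, ∀ t ≤ τ, y n t = freeJet (cosCoeff θ₀) n t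
  rest : ∀ n, ∀ t ≥ T, y n t = 0

theorem exists_isSteering (θ₀ : L2) {τ T s : ℝ} (hτT : τ < T) (hs : 1 < s) (hs2 : s < 2) :
    ∃ y, IsSteering θ₀ τ T s y := by
  obtain ⟨φ, N, B, hN, hB, hφ, hφb, h0, h1, hT⟩ := exists_gevrey_step hτT hs
  refine ⟨leibniz (freeJet (cosCoeff θ₀)) φ, fun a ha => ?_,
    fun n t ht => leibniz_eq_of_one _ _ (h0 t ht) (fun n => h1 n t ht) n,
    fun n t ht => leibniz_eq_zero _ _ (fun n => hT n t ht) n⟩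
  obtain ⟨M, A, h⟩ := exists_isFlatOutput_freeJet (abs_cosCoeff_le θ₀) ha
  have hM := h.M_nonneg
  have hA := h.one_le
  exact ⟨M * N, A + B, by linarith, hs2, by positivity, by linarith,
    h.jet.leibniz (hφ.mono (Set.subset_univ _)),
    IsGevreyJet.leibniz (by linarith) hM (by linarith) hN.le hB.le
      (h.gevrey.mono hs.le hM le_rfl (by linarith) le_rfl) (fun n t _ => hφb n t trivial)⟩

/-- The boundary values of the `x`-derivative of the solution, and their time derivatives. -/
noncomputable def boundaryJet (y : ℕ → ℝ → ℝ) (τ : ℝ) (n : ℕ) (t : ℝ) : ℝ :=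
  if t ≤ τ then 0 else flatSeries y n 1 t 1

namespace IsSteering

variable {θ₀ : L2} {τ T s : ℝ} {y : ℕ → ℝ → ℝ}

theorem isJet (h : IsSteering θ₀ τ T s y) : IsJet (Set.Ioi 0) y := by
  intro n t ht
  obtain ⟨M, A, hf⟩ := h.flat (t / 2) (half_pos ht)
  exact hf.jet n t (Set.mem_Ioi.2 (half_lt_self ht))

theorem boundaryJet_eq (h : IsSteering θ₀ τ T s y) (n : ℕ) {t : ℝ} (ht : 0 < t) :
    boundaryJet y τ n t = flatSeries y n 1 t 1 := by
  unfold boundaryJet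
  split_ifs with htτ
  · rw [flatSeries_congr fun n => h.free n t htτ,
      flatSeries_freeJet_one_one (abs_cosCoeff_le θ₀) n ht]
  · rfl

theorem isJet_boundaryJet (h : IsSteering θ₀ τ T s y) (hτ : 0 < τ) :
    IsJet Set.univ (boundaryJet y τ) := by
  intro n t _
  rcases lt_or_ge t τ with ht | ht
  · have h0 : boundaryJet y τ (n + 1) t = 0 := if_pos ht.le
    rw [h0]
    refine (hasDerivAt_const t (0 : ℝ)).congr_of_eventuallyEq ?_
    filter_upwards [gt_mem_nhds ht] with r hr using if_pos (le_of_lt hr)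
  · have ht0 : 0 < t := hτ.trans_le ht
    obtain ⟨M, A, hf⟩ := h.flat (t / 2) (half_pos ht0)
    rw [h.boundaryJet_eq _ ht0]
    refine (hf.hasDerivAt_time n 1 (half_lt_self ht0) 1).congr_of_eventuallyEq ?_
    filter_upwards [lt_mem_nhds ht0] with r hr using h.boundaryJet_eq n hr

theorem controlTerm_eq (h : IsSteering θ₀ τ T s y) (hτ : 0 < τ) {t : ℝ} (ht : t ∈ Set.Ioc τ T)
    (i : ℕ) : controlTerm τ T (y 0) t i = y (i + 1) t / ((2 * i + 1).factorial : ℝ) := by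
  have ht0 : t ∈ Set.Ioi (0 : ℝ) := hτ.trans ht.1
  unfold controlTerm
  rw [iteratedDerivWithin_eq_iteratedDeriv (uniqueDiffOn_Icc (ht.1.trans_le ht.2)) _
    (Set.Ioc_subset_Icc_self ht), h.isJet.iteratedDeriv_eq isOpen_Ioi _ t ht0]
  exact ((h.isJet.contDiffOn isOpen_Ioi 0).contDiffAt (isOpen_Ioi.mem_nhds ht0)).of_le
    (by exact_mod_cast le_top)

theorem hasSum_controlTerm (h : IsSteering θ₀ τ T s y) (hτ : 0 < τ) {t : ℝ}
    (ht : t ∈ Set.Ioc τ T) : HasSum (controlTerm τ T (y 0) t) (flatSeries y 0 1 t 1) := by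
  obtain ⟨M, A, hf⟩ := h.flat τ hτ
  exact (hf.hasSum_boundary ht.1).congr_fun fun i => h.controlTerm_eq hτ ht i

theorem control_eq (h : IsSteering θ₀ τ T s y) (hτ : 0 < τ) {t : ℝ} (ht : t ≤ T) :
    control τ T (y 0) t = boundaryJet y τ 0 t := by
  unfold control boundaryJet
  split_ifs with h1
  · rfl
  · exact (h.hasSum_controlTerm hτ ⟨not_le.1 h1, ht⟩).tsum_eq

theorem gevreyOn_output (h : IsSteering θ₀ τ T s y) (hτ : 0 < τ) :
    GevreyOn s (y 0) (Set.Icc τ T) := by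
  obtain ⟨M, A, hf⟩ := h.flat (τ / 2) (half_pos hτ)
  have hM := hf.M_nonneg
  have hA := hf.one_le
  have hK : Set.Icc τ T ⊆ Set.Ioi (τ / 2) := fun t ht => (half_lt_self hτ).trans_le ht.1
  exact IsGevreyJet.gevreyOn (M := M + 1) (A := A) (by positivity) (by positivity) isOpen_Ioi hK
    hf.jet (fun n t ht => (hf.gevrey.mono le_rfl hM (by linarith) (by linarith) le_rfl) n t (hK ht))
    fun _ _ => rfl

theorem gevreyOn_control (h : IsSteering θ₀ τ T s y) (hτ : 0 < τ) :
    GevreyOn s (control τ T (y 0)) (Set.Icc 0 T) := by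
  obtain ⟨M, A, hf⟩ := h.flat τ hτ
  have hM := hf.M_nonneg
  have hA := hf.one_le
  set c := (2 : ℝ) ^ s * A
  have hc : 0 < c := by positivity
  set W := ∑' j, flatWeight s c 1 j
  have hW : 0 ≤ W := tsum_nonneg fun j => by unfold flatWeight; positivity
  refine IsGevreyJet.gevreyOn (M := M * (2 * c) * W + 1) (A := c) (by positivity) hc isOpen_univ
    (Set.subset_univ _) (h.isJet_boundaryJet hτ) (fun n t ht => ?_)
    fun t ht => h.control_eq hτ ht.2
  unfold boundaryJet
  split_ifs with htτ
  · rw [abs_zero]; positivity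
  · refine (hf.abs_flatSeries_le one_pos n 1 (not_le.1 htτ) (by simp)).trans ?_
    calc _ = M * (2 * c) * W * (n.factorial : ℝ) ^ s * c ^ n := by
          simp only [Nat.factorial_one, Nat.cast_one, Real.one_rpow, c, W]; ring
      _ ≤ _ := by gcongr; linarith

theorem continuous_flatSeries (h : IsSteering θ₀ τ T s y) (t : ℝ) (ht : 0 < t) :
    Continuous (flatSeries y 0 0 t) := by
  obtain ⟨M, A, hf⟩ := h.flat (t / 2) (half_pos ht)
  exact hf.continuous_space 0 0 (half_lt_self ht)

/-- The trajectory in `L²(0,1)` of the steered system. -/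
noncomputable def state (h : IsSteering θ₀ τ T s y) : ℝ → L2 :=
  trajectory θ₀ (flatSeries y 0 0) h.continuous_flatSeries

theorem continuousOn_state (h : IsSteering θ₀ τ T s y) (hτ : 0 < τ) :
    ContinuousOn h.state (Set.Icc 0 T) := by
  intro t ht
  rcases ht.1.eq_or_lt with rfl | ht0
  · have h1 : Filter.Tendsto h.state (nhdsWithin 0 (Set.Ioi 0)) (nhds θ₀) := by
      refine tendsto_of_inner_cosLp ?_
      filter_upwards [Ioc_mem_nhdsGT hτ] with r hr n
      rw [inner_cosLp, state, integral_trajectory_mul hr.1]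
      simp only [flatSeries_congr fun n => h.free n r hr.2]
      exact integral_flatSeries_freeJet_mul_cosFun θ₀ hr.1 n
    have h2 : ContinuousWithinAt h.state (Set.Ioi 0) 0 := by
      unfold ContinuousWithinAt
      rwa [state, trajectory_zero]
    exact (continuousWithinAt_Ioi_iff_Ici.1 h2).mono Set.Icc_subset_Ici_self
  · refine ContinuousAt.continuousWithinAt ?_
    obtain ⟨M, A, hf⟩ := h.flat (t / 2) (half_pos ht0)
    obtain ⟨C, hC, hL⟩ := hf.abs_sub_le
    rw [ContinuousAt, tendsto_iff_norm_sub_tendsto_zero]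
    have hlim : Filter.Tendsto (fun r => C * |r - t|) (nhds t) (nhds 0) := by
      have : Continuous fun r : ℝ => C * |r - t| := by fun_prop
      simpa using this.tendsto t
    refine squeeze_zero' (Filter.Eventually.of_forall fun r => norm_nonneg _) ?_ hlim
    filter_upwards [lt_mem_nhds (half_lt_self ht0)] with r hr
    refine norm_trajectory_sub_le ht0 ((half_pos ht0).trans hr) (by positivity) fun x hx => ?_
    exact hL t r x (half_lt_self ht0) hr (abs_le.2 ⟨by linarith [hx.1], hx.2.le⟩)

theorem isWeakSolution_state (h : IsSteering θ₀ τ T s y) (hτ : 0 < τ) (hτT : τ < T) :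
    IsWeakSolution T (control τ T (y 0)) θ₀ h.state := by
  have hT : 0 ≤ T := (hτ.trans hτT).le
  have hpair : ∀ g : ℝ → ℝ, Continuous g → ContinuousOn
      (fun r => ∫ x in Set.Ioo (0 : ℝ) 1, h.state r x * g x) (Set.Icc 0 T) := by
    intro g hg
    have hmem := memLp_of_continuousOn (f := g) hg.continuousOn
    have := (innerSL ℝ (hmem.toLp g)).continuous.comp_continuousOn (h.continuousOn_state hτ)
    simp only [Function.comp_def, innerSL_apply_apply] at this
    simpa only [inner_toLp_left] using this
  have hu : ContinuousOn (control τ T (y 0)) (Set.Icc 0 T) := by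
    refine ContinuousOn.congr (f := boundaryJet y τ 0) (fun t _ => ?_)
      fun t ht => h.control_eq hτ ht.2
    exact ((h.isJet_boundaryJet hτ).continuousAt 0 trivial).continuousWithinAt
  have hint : ∀ φ : ℝ → ℝ, ContDiff ℝ 2 φ → ContinuousOn (fun r =>
      (∫ x in Set.Ioo (0 : ℝ) 1, h.state r x * deriv (deriv φ) x) + control τ T (y 0) r * φ 1)
      (Set.Icc 0 T) := by
    intro φ hφ
    have hφ' : ContDiff ℝ (1 + 1) φ := by norm_num; exact hφ
    have hφ'' : Continuous (deriv (deriv φ)) :=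
      (contDiff_succ_iff_deriv.1 hφ').2.2.continuous_deriv le_rfl
    exact (hpair _ hφ'').add (hu.mul continuousOn_const)
  refine ⟨trajectory_zero, fun φ hφ _ _ => ?_, fun φ hφ h0 h1 t ht => ?_⟩
  · refine ContinuousOn.intervalIntegrable ?_
    rw [Set.uIcc_of_le hT]
    exact hint φ hφ
  · have hsub : Set.Icc 0 t ⊆ Set.Icc 0 T := Set.Icc_subset_Icc_right ht.2
    have key := intervalIntegral.integral_eq_sub_of_hasDerivAt_of_le ht.1
      ((hpair φ hφ.continuous).mono hsub)
      (f' := fun r => (∫ x in Set.Ioo (0 : ℝ) 1, h.state r x * deriv (deriv φ) x) +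
        control τ T (y 0) r * φ 1) (fun r hr => ?_)
      (by
        refine ContinuousOn.intervalIntegrable ?_
        rw [Set.uIcc_of_le ht.1]
        exact (hint φ hφ).mono hsub)
    · rw [key]
      have h2 : h.state 0 = θ₀ := trajectory_zero
      rw [h2]
      ring
    · obtain ⟨M, A, hf⟩ := h.flat (r / 2) (half_pos hr.1)
      have hd := hf.hasDerivAt_integral_mul (half_lt_self hr.1) hφ h0 h1
      rw [h.control_eq hτ (hr.2.le.trans ht.2), h.boundaryJet_eq 0 hr.1, state,
        integral_trajectory_mul hr.1]
      refine hd.congr_of_eventuallyEq ?_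
      filter_upwards [lt_mem_nhds hr.1] with v hv using integral_trajectory_mul hv φ

theorem satisfiesHeatEquation (h : IsSteering θ₀ τ T s y) (hτ : 0 < τ) {θ : ℝ → ℝ → ℝ}
    (hθ : ∀ t, 0 < t → θ t = flatSeries y 0 0 t) :
    SatisfiesHeatEquation T (control τ T (y 0)) θ := by
  have hx : ∀ t, 0 < t → ∀ x, HasDerivAt (θ t) (flatSeries y 0 1 t x) x := by
    intro t ht x
    obtain ⟨M, A, hf⟩ := h.flat (t / 2) (half_pos ht)
    rw [hθ t ht]
    exact hf.hasDerivAt_space 0 0 (half_lt_self ht) x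
  refine ⟨fun t ht x _ => ⟨(hx t ht.1 x).differentiableAt, flatSeries y 1 0 t x, ?_, ?_⟩,
    fun t ht => ?_, fun t ht => ?_⟩
  · obtain ⟨M, A, hf⟩ := h.flat (t / 2) (half_pos ht.1)
    refine (hf.hasDerivAt_time 0 0 (half_lt_self ht.1) x).congr_of_eventuallyEq ?_
    filter_upwards [lt_mem_nhds ht.1] with r hr
    rw [hθ r hr]
  · obtain ⟨M, A, hf⟩ := h.flat (t / 2) (half_pos ht.1)
    rw [funext fun x => (hx t ht.1 x).deriv, ← flatSeries_add_two]
    exact hf.hasDerivAt_space 0 1 (half_lt_self ht.1) x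
  · have h1 := hx t ht.1 0
    rw [flatSeries_one_zero] at h1
    exact h1.hasDerivWithinAt
  · rw [h.control_eq hτ ht.2.le, h.boundaryJet_eq 0 ht.1]
    exact (hx t ht.1 1).hasDerivWithinAt

end IsSteering

end HeatControl

theorem theorem1 (θ₀ : HeatControl.L2) (T : ℝ) (hT : 0 < T) (τ : ℝ) (hτ : τ ∈ Set.Ioo 0 T)
    (s : ℝ) (hs : s ∈ Set.Ioo (1 : ℝ) 2) :
    ∃ y : ℝ → ℝ,
      -- the flat output is Gevrey, and the series defining the control converges
      HeatControl.GevreyOn s y (Set.Icc τ T) ∧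
      (∀ t ∈ Set.Ioc τ T, Summable (HeatControl.controlTerm τ T y t)) ∧
      ∃ (Θ : ℝ → HeatControl.L2) (θ : ℝ → ℝ → ℝ),
        -- the system with this control and initial state has exactly one solution on `[0, T]`
        HeatControl.IsWeakSolution T (HeatControl.control τ T y) θ₀ Θ ∧
        (∀ Θ' : ℝ → HeatControl.L2,
          HeatControl.IsWeakSolution T (HeatControl.control τ T y) θ₀ Θ' →
            ∀ t ∈ Set.Icc 0 T, Θ' t = Θ t) ∧
        -- `θ(t, ·)` represents the `L²` class `Θ t`, and satisfies the equations pointwise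
        (∀ t ∈ Set.Icc 0 T,
          (Θ t : ℝ → ℝ) =ᵐ[MeasureTheory.volume.restrict (Set.Ioo (0 : ℝ) 1)] θ t) ∧
        HeatControl.SatisfiesHeatEquation T (HeatControl.control τ T y) θ ∧
        -- the final state is zero
        (∀ x ∈ Set.Ioo (0 : ℝ) 1, θ T x = 0) ∧
        -- regularity
        HeatControl.GevreyOn s (HeatControl.control τ T y) (Set.Icc 0 T) ∧
        ContinuousOn Θ (Set.Icc 0 T) ∧
        (∀ ε ∈ Set.Ioo 0 T,
          HeatControl.GevreyOn₂ s (s / 2) θ (Set.Icc ε T ×ˢ Set.Icc (0 : ℝ) 1)) := by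
  obtain ⟨y, h⟩ := HeatControl.exists_isSteering θ₀ hτ.2 hs.1 hs.2
  have hweak := h.isWeakSolution_state hτ.1 hτ.2
  set θ : ℝ → ℝ → ℝ := fun t => if 0 < t then HeatControl.flatSeries y 0 0 t else θ₀
  have hθ : ∀ t, 0 < t → θ t = HeatControl.flatSeries y 0 0 t := fun t ht => if_pos ht
  refine ⟨y 0, h.gevreyOn_output hτ.1, fun t ht => (h.hasSum_controlTerm hτ.1 ht).summable,
    h.state, θ, hweak, fun Θ' hΘ' t ht => hweak.unique hT.le hΘ' ht, fun t ht => ?_,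
    h.satisfiesHeatEquation hτ.1 hθ, fun x _ => ?_, h.gevreyOn_control hτ.1,
    h.continuousOn_state hτ.1, fun ε hε => ?_⟩
  · rcases ht.1.eq_or_lt with rfl | ht0
    · have h1 : θ 0 = θ₀ := if_neg (lt_irrefl _)
      rw [h1, hweak.initial]
    · rw [hθ t ht0]
      exact HeatControl.coe_trajectory ht0
  · rw [hθ T hT]
    exact HeatControl.flatSeries_eq_zero (fun n => h.rest n T le_rfl) 0 0 x
  · obtain ⟨M, A, hf⟩ := h.flat (ε / 2) (half_pos hε.1)
    have hε2 := half_lt_self hε.1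
    refine hf.gevreyOn₂ one_pos (fun z hz => ⟨hε2.trans_le hz.1.1, ?_⟩) fun z hz => ?_
    · exact abs_le.2 ⟨by linarith [hz.2.1], hz.2.2⟩
    · rw [hθ z.1 (hε.1.trans_le hz.1.1)]
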